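/- Let $\phi$ be purely imaginary such that $q=e^{\phi}$ is not a root of unity, and write $q^{1/2}=e^{\phi/2}$. For $\theta\in\mathbb R$ put $$k_+=-\tfrac12\,(q^{1/2}-q^{-1/2})\,e^{i\theta},\qquad k_-=\overline{k_+},$$ and let $\sigma_+=\begin{pmatrix}0&1\\0&0\end{pmatrix}$, $\sigma_-=\begin{pmatrix}0&0\\1&0\end{pmatrix}$, $\sigma_3=\mathrm{diag}(1,-1)$. For $\alpha,\alpha^*\in\mathbb C$ (here $\alpha^*$ is an independent parameter, not a conjugate) define $2^N\times 2^N$ matrices acting on $V=(\mathbb C^2)^{\otimes N}$ recursively by $\mathcal W_0^{(0)}=\cosh\alpha$, $\mathcal W_1^{(0)}=\cosh\alpha^*$ and, for $N\ge 1$, $$\mathcal W_0^{(N)}=(k_+\sigma_++k_-\sigma_-)\otimes I^{(N-1)}+q^{\sigma_3/2}\otimes \mathcal W_0^{(N-1)},\qquad \mathcal W_1^{(N)}=(k_+\sigma_++k_-\sigma_-)\otimes I^{(N-1)}+q^{-\sigma_3/2}\otimes \mathcal W_1^{(N-1)}.$$ **Lemma.** For every $N\ge 0$ and for generic $\alpha,\alpha^*$,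 the pair $\mathcal W_0^{(N)},\mathcal W_1^{(N)}$ acts on $V$ as a tridiagonal pair of diameter $N$ with shape vector $\big(\binom N0,\binom N1,\dots,\binom NN\big)$, for every $\theta\in\mathbb R$. Here "generic" means: for each $\phi$ and $N$ there is a nonzero polynomial $P\in\mathbb C[x,y]$ such that the assertion holds for all $\theta\in\mathbb R$ and all $\alpha,\alpha^*\in\mathbb C$ with $P(e^{\alpha},e^{\alpha^*})\neq 0$. Explicitly, with $A=\mathcal W_0^{(N)}$ and $B=\mathcal W_1^{(N)}$, the assertion is the following. 1. Both $A$ and $B$ are diagonalizable on $V$. 2. The eigenspaces of $A$ can be ordered as $V_0,\dots,V_N$ such that $B V_n\subseteq V_{n-1}+V_n+V_{n+1}$ and $\dim V_n=\binom Nn$ for $0\le n\le N$, where $V_{-1}=V_{N+1}=0$. 3. The eigenspaces of $B$ can be ordered as $V_0^*,\dots,V_N^*$ such that $A V_s^*\subseteq V_{s-1}^*+V_s^*+V_{s+1}^*$ and $\dim V_s^*=\binom Ns$ for $0\le s\le N$, where $V^*_{-1}=V^*_{N+1}=0$. 4. The only subspaces $W\subseteq V$ with $AW\subseteq W$ and $BW\subseteq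 W$ are $W=0$ and $W=V$. -/

import Mathlib

open scoped Kronecker

section TridiagonalPairs

variable {K V : Type*} [Field K] [AddCommGroup V] [Module K V]

/-- `V` is spanned by the eigenspaces of `A`. -/
def IsDiagonalizable (A : Module.End K V) : Prop :=
  ⨆ μ : K, A.eigenspace μ = ⊤

/-- `U 0, …, U d` lists the (nonzero) eigenspaces of `A`, each exactly once. -/
def IsEigenspaceOrdering (A : Module.End K V) {d : ℕ} (U : Fin (d + 1) → Submodule K V) : Prop :=
  Function.Injective U ∧
    Set.range U = {W : Submodule K V | ∃ μ : K, A.HasEigenvalue μ ∧ W = A.eigenspace μ}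

/-- A standard ordering of the eigenspaces of `A` with respect to `B`: an ordering such that
`B (U n) ⊆ U (n - 1) + U n + U (n + 1)` for all `n`, where `U (-1) = U (d + 1) = 0`. -/
def IsStandardOrdering (A B : Module.End K V) {d : ℕ} (U : Fin (d + 1) → Submodule K V) : Prop :=
  IsEigenspaceOrdering A U ∧
    ∀ n : Fin (d + 1), (U n).map B ≤
      ⨆ m : {m : Fin (d + 1) // (m : ℕ) ≤ (n : ℕ) + 1 ∧ (n : ℕ) ≤ (m : ℕ) + 1}, U m.1

/-- Tridiagonal pairs `A`, `B` on a vector space `V` of finite positive dimension. -/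
structure IsTridiagonalPair (A B : Module.End K V) : Prop where
  finiteDimensional : FiniteDimensional K V
  nontrivial : Nontrivial V
  diagonalizable_left : IsDiagonalizable A
  diagonalizable_right : IsDiagonalizable B
  ordering_left : ∃ (d : ℕ) (U : Fin (d + 1) → Submodule K V), IsStandardOrdering A B U
  ordering_right : ∃ (d : ℕ) (U : Fin (d + 1) → Submodule K V), IsStandardOrdering B A U
  irreducible : ∀ W : Submodule K V, W.map A ≤ W → W.map B ≤ W → W = ⊥ ∨ W = ⊤

/-- The tridiagonal pair `A`, `B` has diameter `d` and shape vector `(ρ 0, …, ρ d)`: the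
eigenspaces of `A` and those of `B` both have standard orderings indexed by `0, …, d`, and in
both orderings the `n`-th eigenspace has dimension `ρ n`. -/
def HasDiameterAndShape (A B : Module.End K V) (d : ℕ) (ρ : ℕ → ℕ) : Prop :=
  (∃ U : Fin (d + 1) → Submodule K V, IsStandardOrdering A B U ∧
      ∀ n : Fin (d + 1), Module.finrank K (U n) = ρ n) ∧
  (∃ U : Fin (d + 1) → Submodule K V, IsStandardOrdering B A U ∧
      ∀ n : Fin (d + 1), Module.finrank K (U n) = ρ n)

end TridiagonalPairs

noncomputable section SpinChain

/-- The scalar `k₊ = -(q^{1/2} - q^{-1/2}) e^{iθ} / 2`, where `q^{1/2} = e^{φ/2}`. -/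
def kPlus (φ : ℂ) (θ : ℝ) : ℂ :=
  -(Complex.exp (φ / 2) - Complex.exp (-φ / 2)) * Complex.exp (Complex.I * θ) / 2

/-- The scalar `k₋`, the complex conjugate of `k₊`. -/
def kMinus (φ : ℂ) (θ : ℝ) : ℂ := star (kPlus φ θ)

/-- The Pauli matrix `σ₊`; the index `0` stands for `f₊` and the index `1` for `f₋`. -/
def sigmaPlus : Matrix (Fin 2) (Fin 2) ℂ := !![0, 1; 0, 0]

/-- The Pauli matrix `σ₋`. -/
def sigmaMinus : Matrix (Fin 2) (Fin 2) ℂ := !![0, 0; 1, 0]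

/-- The matrix `e^{z σ₃}`, where `σ₃ = diag(1, -1)`. In particular `q^{± σ₃ / 2}` is
`expSigmaThree (± φ / 2)`. -/
def expSigmaThree (z : ℂ) : Matrix (Fin 2) (Fin 2) ℂ :=
  !![Complex.exp z, 0; 0, Complex.exp (-z)]

/-- The Kronecker product `X ⊗ Y` of a matrix on `ℂ²` with a matrix on `(ℂ²)^{⊗ N}`, as a matrix
on `(ℂ²)^{⊗ (N + 1)}`. The basis of `(ℂ²)^{⊗ N}` formed by the tensor products of the vectors
`f₊`, `f₋` is indexed by `Fin N → Fin 2`, the leftmost tensor factor having the index `0`. -/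
def tensorLeft {N : ℕ} (X : Matrix (Fin 2) (Fin 2) ℂ)
    (Y : Matrix (Fin N → Fin 2) (Fin N → Fin 2) ℂ) :
    Matrix (Fin (N + 1) → Fin 2) (Fin (N + 1) → Fin 2) ℂ :=
  (X ⊗ₖ Y).submatrix (fun a => (a 0, Fin.tail a)) (fun a => (a 0, Fin.tail a))

/-- The matrix `W₀^{(N)}`, of size `2^N`. -/
def W₀ (φ : ℂ) (θ : ℝ) (α : ℂ) : (N : ℕ) → Matrix (Fin N → Fin 2) (Fin N → Fin 2) ℂ
  | 0 => Complex.cosh α • (1 : Matrix (Fin 0 → Fin 2) (Fin 0 → Fin 2) ℂ)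
  | N + 1 =>
      tensorLeft (kPlus φ θ • sigmaPlus + kMinus φ θ • sigmaMinus)
          (1 : Matrix (Fin N → Fin 2) (Fin N → Fin 2) ℂ)
        + tensorLeft (expSigmaThree (φ / 2)) (W₀ φ θ α N)

/-- The matrix `W₁^{(N)}`, of size `2^N`. -/
def W₁ (φ : ℂ) (θ : ℝ) (αs : ℂ) : (N : ℕ) → Matrix (Fin N → Fin 2) (Fin N → Fin 2) ℂ
  | 0 => Complex.cosh αs • (1 : Matrix (Fin 0 → Fin 2) (Fin 0 → Fin 2) ℂ)
  | N + 1 =>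
      tensorLeft (kPlus φ θ • sigmaPlus + kMinus φ θ • sigmaMinus)
          (1 : Matrix (Fin N → Fin 2) (Fin N → Fin 2) ℂ)
        + tensorLeft (expSigmaThree (-φ / 2)) (W₁ φ θ αs N)

end SpinChain

/-!
Write `p = q^{1/2}`, `w = e^{iθ}`, `x = e^α`, `y = e^{α*}`. Both operators are instances of one
recursion `A_N = X ⊗ 1 + K ⊗ A_{N-1}` (`chain`), and the second one arises from the first one by the
substitution `(p, w, x) ↦ (p⁻¹, -w, y)`, which leaves `X` unchanged.

**Eigenspaces.** The first operator has an eigenbasis of product vectors (`chainEigenvector`): if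
`v` is an eigenvector of `A_{N-1}` with eigenvalue `(z + z⁻¹) / 2`, then `(w z, 1) ⊗ v` and
`(w z⁻¹, 1) ⊗ v` are eigenvectors of `A_N`, and the parameter `z` becomes `z p` and `z p⁻¹`. Hence
the eigenvalues have parameters `x p^{N - 2n}`, with multiplicity `N.choose n`. The second operator
is tridiagonal in this basis by induction on `N` (`chain_mulVec_mem_weightSpan`): the two terms that
would violate this vanish since `q^{-σ₃/2}` maps the site vectors with parameter `z` to multiples of
those with parameter `z p^{∓2}`.

**Irreducibility.** It is enough to find one pair `(x, y)` for which the two operators generate the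
full matrix algebra, since this is an open condition (`exists_ne_zero_adjoin_eq_top`): the
determinant of words that equal the matrix units at one point is a polynomial. Such a pair is found
near infinity. A `q`-commutator of the two operators is, up to scalars, the ladder operator
`∑ⱼ 1 ⊗ ⋯ ⊗ σ₊ ⊗ (A_{j-1} + B_{j-1})`, and the opposite one is its analogue with `σ₋`
(`qCommutator_chain`, `qCommutator_chain'`). If the boundary parameters `cosh α`, `cosh α*` tend to
infinity, then after rescaling these four operators tend to two diagonal ones and to the ladder
operators of the diagonal matrices `c q^{σ₃/2} ⊗ ⋯ ⊗ q^{σ₃/2} + c' q^{-σ₃/2} ⊗ ⋯ ⊗ q^{-σ₃/2}`, where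
the ratio of `c` and `c'` is free. For `c = p⁻¹`, `c' = -p` the limit algebra is everything
(`adjoin_limitGen`). It contains the projector onto `f₊ ⊗ ⋯ ⊗ f₊` and is closed under transposition,
so it suffices that this vector is cyclic (`eq_top_of_allPlus_mem`). The special ratio makes the
`N`-th power of the lowering operator on `N + 1` sites map `f₊ ⊗ f₊^{⊗ N}` to a multiple of
`f₊ ⊗ f₋^{⊗ N}`, whence an invariant subspace containing the former contains `ℂ² ⊗ f₋^{⊗ N}`. The
vectors `v` for which it contains `ℂ² ⊗ v` are invariant under the limit algebra on `N` sites, and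
induction applies.

The polynomial does not depend on `w`, because conjugation by `diag(w, 1)^{⊗ N}` removes `w`.
-/

/-! ### Tensor products with a spin one half -/

section Tensor

variable {R : Type*} [CommRing R] {N : ℕ}

/-- The Kronecker product `X ⊗ Y` of a `2 × 2` matrix with a matrix on `(R²)^{⊗ N}`, over an
arbitrary commutative ring; over `ℂ` it is `tensorLeft`. -/
def siteTensor (X : Matrix (Fin 2) (Fin 2) R) (Y : Matrix (Fin N → Fin 2) (Fin N → Fin 2) R) :
    Matrix (Fin (N + 1) → Fin 2) (Fin (N + 1) → Fin 2) R :=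
  Matrix.of fun a b => X (a 0) (b 0) * Y (Fin.tail a) (Fin.tail b)

/-- The tensor product `u ⊗ v` of a vector of `R²` with a vector of `(R²)^{⊗ N}`, as a bilinear
map. -/
def siteVec : (Fin 2 → R) →ₗ[R] ((Fin N → Fin 2) → R) →ₗ[R] ((Fin (N + 1) → Fin 2) → R) :=
  LinearMap.mk₂ R (fun u v a => u (a 0) * v (Fin.tail a))
    (fun _ _ _ => funext fun _ => add_mul _ _ _) (fun _ _ _ => funext fun _ => mul_assoc _ _ _)
    (fun _ _ _ => funext fun _ => mul_add _ _ _) (fun _ _ _ => funext fun _ => mul_left_comm _ _ _)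

theorem siteVec_apply (u : Fin 2 → R) (v : (Fin N → Fin 2) → R) (a : Fin (N + 1) → Fin 2) :
    siteVec u v a = u (a 0) * v (Fin.tail a) := rfl

theorem tensorLeft_eq_siteTensor (X : Matrix (Fin 2) (Fin 2) ℂ)
    (Y : Matrix (Fin N → Fin 2) (Fin N → Fin 2) ℂ) : tensorLeft X Y = siteTensor X Y := rfl

theorem sum_spin_succ {M : Type*} [AddCommMonoid M] (f : (Fin (N + 1) → Fin 2) → M) :
    ∑ a, f a = ∑ e : Fin 2, ∑ b : Fin N → Fin 2, f (Fin.cons e b) := by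
  rw [← Fintype.sum_prod_type']
  exact (Fintype.sum_equiv (Fin.consEquiv fun _ => Fin 2) _ _ fun _ => rfl).symm

theorem siteTensor_mul (X X' : Matrix (Fin 2) (Fin 2) R)
    (Y Y' : Matrix (Fin N → Fin 2) (Fin N → Fin 2) R) :
    siteTensor X Y * siteTensor X' Y' = siteTensor (X * X') (Y * Y') := by
  ext a b
  simp only [siteTensor, Matrix.mul_apply, Matrix.of_apply, sum_spin_succ, Fin.cons_zero,
    Fin.tail_cons, Finset.sum_mul_sum]
  exact Finset.sum_congr rfl fun _ _ => Finset.sum_congr rfl fun _ _ => by ring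

theorem siteTensor_mulVec (X : Matrix (Fin 2) (Fin 2) R)
    (Y : Matrix (Fin N → Fin 2) (Fin N → Fin 2) R) (u : Fin 2 → R) (v : (Fin N → Fin 2) → R) :
    Matrix.mulVec (siteTensor X Y) (siteVec u v) = siteVec (X.mulVec u) (Y.mulVec v) := by
  ext a
  simp only [siteTensor, Matrix.mulVec, dotProduct, Matrix.of_apply, sum_spin_succ, Fin.cons_zero,
    Fin.tail_cons, siteVec_apply, Finset.sum_mul_sum]
  exact Finset.sum_congr rfl fun _ _ => Finset.sum_congr rfl fun _ _ => by ring

theorem siteTensor_add_left (X X' : Matrix (Fin 2) (Fin 2) R)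
    (Y : Matrix (Fin N → Fin 2) (Fin N → Fin 2) R) :
    siteTensor (X + X') Y = siteTensor X Y + siteTensor X' Y := by
  ext a b; simp [siteTensor, add_mul]

theorem siteTensor_add_right (X : Matrix (Fin 2) (Fin 2) R)
    (Y Y' : Matrix (Fin N → Fin 2) (Fin N → Fin 2) R) :
    siteTensor X (Y + Y') = siteTensor X Y + siteTensor X Y' := by
  ext a b; simp [siteTensor, mul_add]

theorem siteTensor_smul_left (r : R) (X : Matrix (Fin 2) (Fin 2) R)
    (Y : Matrix (Fin N → Fin 2) (Fin N → Fin 2) R) :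
    siteTensor (r • X) Y = r • siteTensor X Y := by
  ext a b; simp [siteTensor, mul_assoc]

theorem siteTensor_smul_right (r : R) (X : Matrix (Fin 2) (Fin 2) R)
    (Y : Matrix (Fin N → Fin 2) (Fin N → Fin 2) R) :
    siteTensor X (r • Y) = r • siteTensor X Y := by
  ext a b; simp [siteTensor, mul_left_comm]

theorem siteTensor_one_one :
    siteTensor (1 : Matrix (Fin 2) (Fin 2) R) (1 : Matrix (Fin N → Fin 2) (Fin N → Fin 2) R)
      = 1 := by
  ext a b
  have : a = b ↔ a 0 = b 0 ∧ Fin.tail a = Fin.tail b := by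
    constructor
    · rintro rfl; exact ⟨rfl, rfl⟩
    · rintro ⟨h1, h2⟩
      rw [← Fin.cons_self_tail a, ← Fin.cons_self_tail b, h1, h2]
  simp only [siteTensor, Matrix.of_apply, Matrix.one_apply, this]
  split_ifs <;> simp_all

theorem siteTensor_zero_left (Y : Matrix (Fin N → Fin 2) (Fin N → Fin 2) R) :
    siteTensor 0 Y = 0 := by
  ext a b; simp [siteTensor]

theorem siteTensor_transpose (X : Matrix (Fin 2) (Fin 2) R)
    (Y : Matrix (Fin N → Fin 2) (Fin N → Fin 2) R) :
    (siteTensor X Y).transpose = siteTensor X.transpose Y.transpose := rfl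

theorem siteTensor_map {S : Type*} [CommRing S] (f : R →+* S) (X : Matrix (Fin 2) (Fin 2) R)
    (Y : Matrix (Fin N → Fin 2) (Fin N → Fin 2) R) :
    (siteTensor X Y).map f = siteTensor (X.map f) (Y.map f) := by
  ext a b; simp [siteTensor]

/-- Every vector of `R² ⊗ (R²)^{⊗ N}` is `f₊ ⊗ v₊ + f₋ ⊗ v₋`. -/
theorem eq_siteVec_add_siteVec (v : (Fin (N + 1) → Fin 2) → R) :
    v = siteVec ![1, 0] (fun b => v (Fin.cons 0 b))
      + siteVec ![0, 1] fun b => v (Fin.cons 1 b) := by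
  ext a
  rw [← Fin.cons_self_tail a]
  generalize a 0 = e
  fin_cases e <;> simp [siteVec_apply]

end Tensor

/-! ### The spin chain over a commutative ring -/

section Chain

variable {R : Type*} [CommRing R]

/-- The operator `A_N` with `A_0 = c` and `A_N = X ⊗ 1 + K ⊗ A_{N-1}`. -/
def chain (X K : Matrix (Fin 2) (Fin 2) R) (c : R) :
    (N : ℕ) → Matrix (Fin N → Fin 2) (Fin N → Fin 2) R
  | 0 => c • 1
  | N + 1 => siteTensor X 1 + siteTensor K (chain X K c N)

/-- The operator `∑ⱼ 1 ⊗ ⋯ ⊗ σ ⊗ S_{j-1}`, where `σ` sits on the `j`-th site from the right and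
`S_{j-1}` acts on the `j - 1` sites to the right of it. -/
def ladder (σ : Matrix (Fin 2) (Fin 2) R)
    (S : (N : ℕ) → Matrix (Fin N → Fin 2) (Fin N → Fin 2) R) :
    (N : ℕ) → Matrix (Fin N → Fin 2) (Fin N → Fin 2) R
  | 0 => 0
  | N + 1 => siteTensor σ (S N) + siteTensor 1 (ladder σ S N)

/-- The matrix `a σ₊ + b σ₋`. -/
def offDiag (a b : R) : Matrix (Fin 2) (Fin 2) R := !![0, a; b, 0]

/-- The diagonal matrix with entries `p`, `p'`. -/
def diagTwo (p p' : R) : Matrix (Fin 2) (Fin 2) R := !![p, 0; 0, p']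

theorem chain_map {S : Type*} [CommRing S] (f : R →+* S) (X K : Matrix (Fin 2) (Fin 2) R) (c : R)
    (N : ℕ) : (chain X K c N).map f = chain (X.map f) (K.map f) (f c) N := by
  induction N with
  | zero => ext a b; simp [chain, Matrix.one_apply, apply_ite f]
  | succ N ih =>
    rw [chain, chain, Matrix.map_add f (map_add f), siteTensor_map, siteTensor_map, ih,
      Matrix.map_one f (map_zero f) (map_one f)]

theorem ladder_map {S : Type*} [CommRing S] (f : R →+* S) (σ : Matrix (Fin 2) (Fin 2) R)
    (T : (N : ℕ) → Matrix (Fin N → Fin 2) (Fin N → Fin 2) R) (N : ℕ) :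
    (ladder σ T N).map f = ladder (σ.map f) (fun M => (T M).map f) N := by
  induction N with
  | zero => ext a b; simp [ladder]
  | succ N ih =>
    rw [ladder, ladder, Matrix.map_add f (map_add f), siteTensor_map, siteTensor_map, ih,
      Matrix.map_one f (map_zero f) (map_one f)]

theorem chain_smul (r : R) (X K : Matrix (Fin 2) (Fin 2) R) (c : R) (N : ℕ) :
    chain (r • X) K (r * c) N = r • chain X K c N := by
  induction N with
  | zero => simp [chain, mul_smul]
  | succ N ih => rw [chain, chain, ih, siteTensor_smul_left, siteTensor_smul_right, smul_add]

/-- A gauge transformation of the single site lifts to the chain. -/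
theorem chain_gauge {d X X' K : Matrix (Fin 2) (Fin 2) R} (hX : d * X = X' * d)
    (hK : d * K = K * d) (c : R) (N : ℕ) :
    chain 0 d 1 N * chain X K c N = chain X' K c N * chain 0 d 1 N := by
  induction N with
  | zero => simp [chain]
  | succ N ih =>
    simp only [chain, siteTensor_zero_left, zero_add, mul_add, add_mul, siteTensor_mul, ih, hX, hK,
      mul_one, one_mul]

theorem chain_zero_mul (d d' : Matrix (Fin 2) (Fin 2) R) (c c' : R) (N : ℕ) :
    chain 0 d c N * chain 0 d' c' N = chain 0 (d * d') (c * c') N := by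
  induction N with
  | zero => simp [chain, smul_smul, mul_comm]
  | succ N ih => simp only [chain, siteTensor_zero_left, zero_add, siteTensor_mul, ih]

theorem chain_zero_one (N : ℕ) : chain (0 : Matrix (Fin 2) (Fin 2) R) 1 1 N = 1 := by
  induction N with
  | zero => simp [chain]
  | succ N ih => simp only [chain, siteTensor_zero_left, zero_add, ih, siteTensor_one_one]

/-- The `q`-commutator of the two chains has no `σ₋`-part: up to a scalar it is a ladder
operator built from `σ₊`. -/
theorem qCommutator_chain (p p' a b c c' : R) (hp : p * p' = 1) (N : ℕ) :
    p • (chain (offDiag a b) (diagTwo p p') c N * chain (offDiag a b) (diagTwo p' p) c' N)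
      - p' • (chain (offDiag a b) (diagTwo p' p) c' N * chain (offDiag a b) (diagTwo p p') c N)
      = ((p - p') * (N * (a * b) + c * c')) • 1
        + (a * (p ^ 2 - p' ^ 2)) • ladder (offDiag 1 0) (fun M =>
          chain (offDiag a b) (diagTwo p p') c M + chain (offDiag a b) (diagTwo p' p) c' M) N := by
  induction N with
  | zero =>
    ext i j
    simp [chain, ladder, smul_smul, Matrix.one_apply]
    split_ifs <;> ring
  | succ N ih =>
    set A := chain (offDiag a b) (diagTwo p p') c N
    set B := chain (offDiag a b) (diagTwo p' p) c' N
    have hXX : offDiag a b * offDiag a b = (a * b) • (1 : Matrix (Fin 2) (Fin 2) R) := by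
      ext i j; fin_cases i <;> fin_cases j <;> simp [offDiag, mul_comm]
    have hKK : diagTwo p p' * diagTwo p' p = 1 := by
      ext i j; fin_cases i <;> fin_cases j <;> simp [diagTwo, hp, mul_comm p' p]
    have hKK' : diagTwo p' p * diagTwo p p' = 1 := by
      ext i j; fin_cases i <;> fin_cases j <;> simp [diagTwo, hp, mul_comm p' p]
    have h1 : p • (offDiag a b * diagTwo p' p) = p' • (diagTwo p' p * offDiag a b)
        + (a * (p ^ 2 - p' ^ 2)) • offDiag 1 0 := by
      ext i j; fin_cases i <;> fin_cases j <;> simp [diagTwo, offDiag]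
      · ring
      · ring
    have h2 : p • (diagTwo p p' * offDiag a b) = p' • (offDiag a b * diagTwo p p')
        + (a * (p ^ 2 - p' ^ 2)) • offDiag 1 0 := by
      ext i j; fin_cases i <;> fin_cases j <;> simp [diagTwo, offDiag]
      · ring
      · ring
    have h1' := congrArg (fun Y => siteTensor Y B) h1
    have h2' := congrArg (fun Y => siteTensor Y A) h2
    have h3' := congrArg (fun Y => siteTensor (1 : Matrix (Fin 2) (Fin 2) R) Y) ih
    have hsub : ∀ Y Y' : Matrix (Fin N → Fin 2) (Fin N → Fin 2) R,
        siteTensor (1 : Matrix (Fin 2) (Fin 2) R) (Y - Y')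
          = siteTensor 1 Y - siteTensor 1 Y' := fun Y Y' => by
      ext i j; simp [siteTensor, mul_sub]
    simp only [siteTensor_add_left, siteTensor_smul_left, siteTensor_smul_right, hsub,
      siteTensor_add_right, siteTensor_one_one] at h1' h2' h3'
    simp only [chain, ladder, mul_add, add_mul, siteTensor_mul, hXX, hKK, hKK', mul_one, one_mul,
      siteTensor_smul_left, siteTensor_one_one, smul_add, siteTensor_add_right]
    rw [h1', h2', sub_eq_iff_eq_add.mp h3']
    push_cast
    module

theorem chain_transpose (X K : Matrix (Fin 2) (Fin 2) R) (c : R) (N : ℕ) :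
    (chain X K c N).transpose = chain X.transpose K.transpose c N := by
  induction N with
  | zero => simp [chain]
  | succ N ih => rw [chain, chain, Matrix.transpose_add, siteTensor_transpose,
      siteTensor_transpose, ih, Matrix.transpose_one]

theorem ladder_transpose (σ : Matrix (Fin 2) (Fin 2) R)
    (S : (N : ℕ) → Matrix (Fin N → Fin 2) (Fin N → Fin 2) R) (N : ℕ) :
    (ladder σ S N).transpose = ladder σ.transpose (fun M => (S M).transpose) N := by
  induction N with
  | zero => simp [ladder]
  | succ N ih => rw [ladder, ladder, Matrix.transpose_add, siteTensor_transpose,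
      siteTensor_transpose, ih, Matrix.transpose_one]

theorem offDiag_transpose (a b : R) : (offDiag a b).transpose = offDiag b a := by
  ext i j; fin_cases i <;> fin_cases j <;> rfl

theorem diagTwo_transpose (p p' : R) : (diagTwo p p').transpose = diagTwo p p' := by
  ext i j; fin_cases i <;> fin_cases j <;> rfl

/-- The transpose of `qCommutator_chain`: the opposite `q`-commutator gives the ladder operator
built from `σ₋`. -/
theorem qCommutator_chain' (p p' a b c c' : R) (hp : p * p' = 1) (N : ℕ) :
    p • (chain (offDiag a b) (diagTwo p' p) c' N * chain (offDiag a b) (diagTwo p p') c N)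
      - p' • (chain (offDiag a b) (diagTwo p p') c N * chain (offDiag a b) (diagTwo p' p) c' N)
      = ((p - p') * (N * (a * b) + c * c')) • 1
        + (b * (p ^ 2 - p' ^ 2)) • ladder (offDiag 0 1) (fun M =>
          chain (offDiag a b) (diagTwo p p') c M + chain (offDiag a b) (diagTwo p' p) c' M) N := by
  have := congrArg Matrix.transpose (qCommutator_chain p p' b a c c' hp N)
  simpa only [Matrix.transpose_sub, Matrix.transpose_add, Matrix.transpose_smul,
    Matrix.transpose_mul, Matrix.transpose_one, chain_transpose, ladder_transpose,
    offDiag_transpose, diagTwo_transpose, mul_comm b a] using this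

end Chain

/-! ### The eigenbasis of a chain -/

section Eigenbasis

/-- The single-site matrix `k₊ σ₊ + k₋ σ₋`, where `k₊ = -(p - p⁻¹) w / 2` and
`k₋ = (p - p⁻¹) w⁻¹ / 2`, in terms of `p = q^{1/2}` and `w = e^{iθ}`. -/
noncomputable def spinX (p w : ℂ) : Matrix (Fin 2) (Fin 2) ℂ :=
  offDiag (-((p - p⁻¹) / 2 * w)) ((p - p⁻¹) / 2 * w⁻¹)

/-- The number of sites of a configuration that carry `f₋`. -/
def minusCount {N : ℕ} (a : Fin N → Fin 2) : ℕ := ∑ i, (a i : ℕ)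

/-- The spectral parameter `z = x p^{N - 2n}`; the `n`-th eigenvalue of a chain of length `N`
is `(z + z⁻¹) / 2`. -/
noncomputable def spectralParam (p x : ℂ) (N : ℕ) (n : ℤ) : ℂ := x * p ^ ((N : ℤ) - 2 * n)

/-- The two eigenvectors of the `2 × 2` matrix `k₊ σ₊ + k₋ σ₋ + ((z + z⁻¹) / 2) q^{σ₃ / 2}`. -/
noncomputable def siteEigenvector (w z : ℂ) : Fin 2 → Fin 2 → ℂ := ![![w * z, 1], ![w * z⁻¹, 1]]

/-- The product eigenvectors of a chain. The spectral parameter of the factor on each site is that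
of the product of the factors to the right of it. -/
noncomputable def chainEigenvector (p w x : ℂ) :
    (N : ℕ) → (Fin N → Fin 2) → (Fin N → Fin 2) → ℂ
  | 0, _ => fun _ => 1
  | N + 1, a => siteVec
      (siteEigenvector w (spectralParam p x N (minusCount (Fin.tail a))) (a 0))
      (chainEigenvector p w x N (Fin.tail a))

/-- The span of the product eigenvectors whose label has exactly `n` minus signs. -/
noncomputable def weightSpan (p w x : ℂ) (N : ℕ) (n : ℤ) : Submodule ℂ ((Fin N → Fin 2) → ℂ) :=
  Submodule.span ℂ (chainEigenvector p w x N '' {a | (minusCount a : ℤ) = n})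

theorem minusCount_succ {N : ℕ} (a : Fin (N + 1) → Fin 2) :
    minusCount a = a 0 + minusCount (Fin.tail a) := by
  simp [minusCount, Fin.sum_univ_succ, Fin.tail]

theorem minusCount_le {N : ℕ} (a : Fin N → Fin 2) : minusCount a ≤ N := by
  refine (Finset.sum_le_card_nsmul _ _ 1 fun i _ => by omega).trans ?_
  simp

theorem spectralParam_ne_zero {p x : ℂ} (hp : p ≠ 0) (hx : x ≠ 0) (N : ℕ) (n : ℤ) :
    spectralParam p x N n ≠ 0 := mul_ne_zero hx (zpow_ne_zero _ hp)

theorem spectralParam_succ {p x : ℂ} (hp : p ≠ 0) (N : ℕ) (n : ℤ) :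
    spectralParam p x (N + 1) n = spectralParam p x N n * p := by
  rw [spectralParam, spectralParam, mul_assoc, ← zpow_add_one₀ hp]
  congr 2; push_cast; ring

theorem spectralParam_succ_succ {p x : ℂ} (hp : p ≠ 0) (N : ℕ) (n : ℤ) :
    spectralParam p x (N + 1) (n + 1) = spectralParam p x N n * p⁻¹ := by
  rw [spectralParam, spectralParam, mul_assoc, ← zpow_sub_one₀ hp]
  congr 2; push_cast; ring

theorem spectralParam_add_one {p x : ℂ} (hp : p ≠ 0) (N : ℕ) (n : ℤ) :
    spectralParam p x N (n + 1) = spectralParam p x N n * p⁻¹ * p⁻¹ := by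
  rw [spectralParam, spectralParam, mul_assoc, mul_assoc, ← mul_assoc (p ^ _),
    ← zpow_sub_one₀ hp, ← zpow_sub_one₀ hp]
  congr 2; ring

theorem spectralParam_sub_one {p x : ℂ} (hp : p ≠ 0) (N : ℕ) (n : ℤ) :
    spectralParam p x N (n - 1) = spectralParam p x N n * p * p := by
  rw [spectralParam, spectralParam, mul_assoc, mul_assoc, ← mul_assoc (p ^ _),
    ← zpow_add_one₀ hp, ← zpow_add_one₀ hp]
  congr 2; ring

theorem spectralParam_sq {p x : ℂ} (N : ℕ) (n : ℤ) :
    spectralParam p x N n ^ 2 = x ^ 2 * p ^ (2 * ((N : ℤ) - 2 * n)) := by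
  rw [spectralParam, mul_pow, zpow_mul', zpow_ofNat]

/-- The single-site eigenvalue equations: the spectral parameter is multiplied by `p^{±1}`. -/
theorem siteEigenvector_eigen {p w z : ℂ} (hp : p ≠ 0) (hw : w ≠ 0) (hz : z ≠ 0) :
    ∀ e, (spinX p w).mulVec (siteEigenvector w z e)
      + ((z + z⁻¹) / 2) • (diagTwo p p⁻¹).mulVec (siteEigenvector w z e)
      = (![(z * p + (z * p)⁻¹) / 2, (z * p⁻¹ + (z * p⁻¹)⁻¹) / 2] e) • siteEigenvector w z e := by
  intro e
  ext i
  fin_cases e <;> fin_cases i <;>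
    simp [spinX, siteEigenvector, offDiag, diagTwo] <;>
    field_simp <;> ring

theorem chain_mulVec_chainEigenvector {p w x : ℂ} (hp : p ≠ 0) (hw : w ≠ 0) (hx : x ≠ 0) (N : ℕ)
    (a : Fin N → Fin 2) :
    (chain (spinX p w) (diagTwo p p⁻¹) ((x + x⁻¹) / 2) N).mulVec (chainEigenvector p w x N a)
      = ((spectralParam p x N (minusCount a) + (spectralParam p x N (minusCount a))⁻¹) / 2)
        • chainEigenvector p w x N a := by
  induction N with
  | zero => ext b; simp [chain, chainEigenvector, spectralParam, minusCount, Matrix.smul_mulVec]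
  | succ N ih =>
    have h := siteEigenvector_eigen hp hw
      (spectralParam_ne_zero hp hx N (minusCount (Fin.tail a))) (a 0)
    have hs : ∀ e : Fin 2, (![(spectralParam p x N (minusCount (Fin.tail a)) * p
        + (spectralParam p x N (minusCount (Fin.tail a)) * p)⁻¹) / 2,
        (spectralParam p x N (minusCount (Fin.tail a)) * p⁻¹
        + (spectralParam p x N (minusCount (Fin.tail a)) * p⁻¹)⁻¹) / 2] : Fin 2 → ℂ) e
        = (spectralParam p x (N + 1) (((e : ℕ) + minusCount (Fin.tail a) : ℕ) : ℤ)
          + (spectralParam p x (N + 1) (((e : ℕ) + minusCount (Fin.tail a) : ℕ) : ℤ))⁻¹) / 2 := by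
      intro e
      fin_cases e
      · simp [spectralParam_succ hp]
      · simp [← spectralParam_succ_succ hp, add_comm]
    rw [hs] at h
    rw [chain, chainEigenvector, Matrix.add_mulVec, siteTensor_mulVec, siteTensor_mulVec, ih,
      Matrix.one_mulVec, map_smul, minusCount_succ, ← LinearMap.smul_apply, ← map_smul,
      ← LinearMap.add_apply, ← map_add, h, map_smul, LinearMap.smul_apply]

/-- The two eigenvectors on a site span `ℂ²` unless `z = z⁻¹`. -/
theorem exists_eq_siteEigenvector {w z : ℂ} (hw : w ≠ 0) (hz : z ≠ 0) (hz2 : z ^ 2 ≠ 1)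
    (u : Fin 2 → ℂ) :
    ∃ r s : ℂ, u = r • siteEigenvector w z 0 + s • siteEigenvector w z 1 := by
  have h : z ^ 2 - 1 ≠ 0 := sub_ne_zero.mpr hz2
  refine ⟨(u 0 * w⁻¹ * z - u 1) / (z ^ 2 - 1), u 1 - (u 0 * w⁻¹ * z - u 1) / (z ^ 2 - 1), ?_⟩
  ext i
  fin_cases i
  · simp [siteEigenvector]; field_simp; ring
  · simp [siteEigenvector]

theorem siteVec_zero_mem_weightSpan {p w x : ℂ} {N : ℕ} {n : ℤ} {v : (Fin N → Fin 2) → ℂ}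
    (hv : v ∈ weightSpan p w x N n) :
    siteVec (siteEigenvector w (spectralParam p x N n) 0) v ∈ weightSpan p w x (N + 1) n := by
  suffices weightSpan p w x N n ≤ (weightSpan p w x (N + 1) n).comap
    (siteVec (siteEigenvector w (spectralParam p x N n) 0)) from this hv
  refine Submodule.span_le.mpr ?_
  rintro _ ⟨a, rfl, rfl⟩
  refine Submodule.subset_span ⟨Fin.cons 0 a, ?_, ?_⟩
  · simp [minusCount_succ]
  · simp [chainEigenvector]

theorem siteVec_one_mem_weightSpan {p w x : ℂ} {N : ℕ} {n : ℤ} {v : (Fin N → Fin 2) → ℂ}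
    (hv : v ∈ weightSpan p w x N n) :
    siteVec (siteEigenvector w (spectralParam p x N n) 1) v ∈ weightSpan p w x (N + 1) (n + 1) := by
  suffices weightSpan p w x N n ≤ (weightSpan p w x (N + 1) (n + 1)).comap
    (siteVec (siteEigenvector w (spectralParam p x N n) 1)) from this hv
  refine Submodule.span_le.mpr ?_
  rintro _ ⟨a, rfl, rfl⟩
  refine Submodule.subset_span ⟨Fin.cons 1 a, ?_, ?_⟩
  · simp [minusCount_succ, add_comm]
  · simp [chainEigenvector]

theorem weightSpan_eq_bot {p w x : ℂ} {N : ℕ} {n : ℤ} (hn : n < 0 ∨ (N : ℤ) < n) :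
    weightSpan p w x N n = ⊥ := by
  rw [weightSpan, Submodule.span_eq_bot]
  rintro _ ⟨a, ha, rfl⟩
  have := minusCount_le a
  simp only [Set.mem_ofPred_eq] at ha
  omega

/-- The parameter `x` is generic up to length `N`: `x p^j ≠ ±1` for `|j| ≤ N`. This keeps the two
eigenvectors on each site independent, and is the part of the distinctness of the eigenvalues
`(z + z⁻¹) / 2` that concerns `z z' = 1`. -/
def IsGenericParam (p x : ℂ) (N : ℕ) : Prop := ∀ j : ℤ, |j| ≤ N → x ^ 2 * p ^ (2 * j) ≠ 1

theorem IsGenericParam.mono {p x : ℂ} {M N : ℕ} (h : IsGenericParam p x N) (hMN : M ≤ N) :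
    IsGenericParam p x M := fun j hj => h j (hj.trans (by exact_mod_cast hMN))

theorem IsGenericParam.spectralParam_sq_ne_one {p x : ℂ} {N : ℕ} (h : IsGenericParam p x N) {n : ℤ}
    (h0 : 0 ≤ n) (hN : n ≤ N) : spectralParam p x N n ^ 2 ≠ 1 := by
  rw [spectralParam_sq]
  exact h _ (abs_le.mpr ⟨by linarith, by linarith⟩)

theorem siteVec_mem_weightSpan {p w x : ℂ} (hp : p ≠ 0) (hw : w ≠ 0) (hx : x ≠ 0) {N : ℕ}
    (hgen : IsGenericParam p x N) {n : ℤ} (u : Fin 2 → ℂ) {v : (Fin N → Fin 2) → ℂ}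
    (hv : v ∈ weightSpan p w x N n) :
    siteVec u v ∈ weightSpan p w x (N + 1) n ⊔ weightSpan p w x (N + 1) (n + 1) := by
  by_cases hn : n < 0 ∨ (N : ℤ) < n
  · rw [weightSpan_eq_bot hn, Submodule.mem_bot] at hv
    rw [hv, map_zero]; exact Submodule.zero_mem _
  push Not at hn
  obtain ⟨r, s, rfl⟩ := exists_eq_siteEigenvector hw (spectralParam_ne_zero hp hx N n)
    (hgen.spectralParam_sq_ne_one hn.1 hn.2) u
  rw [map_add, LinearMap.add_apply, map_smul, map_smul]
  exact Submodule.add_mem_sup (Submodule.smul_mem _ _ (siteVec_zero_mem_weightSpan hv))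
    (Submodule.smul_mem _ _ (siteVec_one_mem_weightSpan hv))

theorem span_chainEigenvector {p w x : ℂ} (hp : p ≠ 0) (hw : w ≠ 0) (hx : x ≠ 0) {N : ℕ}
    (hgen : IsGenericParam p x N) :
    Submodule.span ℂ (Set.range (chainEigenvector p w x N)) = ⊤ := by
  induction N with
  | zero =>
    refine (Submodule.eq_top_iff').mpr fun v => ?_
    have : v = v 0 • chainEigenvector p w x 0 0 := by
      ext b; simp [chainEigenvector, Subsingleton.elim b 0]
    rw [this]
    exact Submodule.smul_mem _ _ (Submodule.subset_span ⟨0, rfl⟩)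
  | succ N ih =>
    have hN := hgen.mono N.le_succ
    have hle : ∀ n, weightSpan p w x (N + 1) n
        ≤ Submodule.span ℂ (Set.range (chainEigenvector p w x (N + 1))) := fun n =>
      Submodule.span_mono (Set.image_subset_range _ _)
    have key : ∀ u v, siteVec u v
        ∈ Submodule.span ℂ (Set.range (chainEigenvector p w x (N + 1))) := by
      intro u v
      have hv : v ∈ Submodule.span ℂ (Set.range (chainEigenvector p w x N)) := by
        rw [ih hN]; trivial
      suffices Submodule.span ℂ (Set.range (chainEigenvector p w x N)) ≤
        (Submodule.span ℂ (Set.range (chainEigenvector p w x (N + 1)))).comap (siteVec u) from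
        this hv
      refine Submodule.span_le.mpr ?_
      rintro _ ⟨a, rfl⟩
      exact sup_le (hle _) (hle _) (siteVec_mem_weightSpan hp hw hx hN u
        (Submodule.subset_span ⟨a, rfl, rfl⟩))
    refine (Submodule.eq_top_iff').mpr fun v => ?_
    rw [eq_siteVec_add_siteVec v]
    exact Submodule.add_mem _ (key _ _) (key _ _)

/-- The second chain is tridiagonal in the eigenbasis of the first. The term that would move the
weight by two vanishes, since `q^{-σ₃/2}` maps the first eigenvector on the new site with
parameter `z` to a multiple of the one with parameter `z p⁻²`, and likewise the second one. -/
theorem chain_mulVec_mem_weightSpan {p w x : ℂ} (hp : p ≠ 0) (hw : w ≠ 0) (hx : x ≠ 0)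
    (X : Matrix (Fin 2) (Fin 2) ℂ) (c : ℂ) {N : ℕ} (hgen : IsGenericParam p x N)
    (a : Fin N → Fin 2) :
    (chain X (diagTwo p⁻¹ p) c N).mulVec (chainEigenvector p w x N a)
      ∈ weightSpan p w x N (minusCount a - 1) ⊔ weightSpan p w x N (minusCount a)
        ⊔ weightSpan p w x N (minusCount a + 1) := by
  induction N with
  | zero =>
    rw [chain, Matrix.smul_mulVec, Matrix.one_mulVec]
    exact Submodule.mem_sup_left (Submodule.mem_sup_right
      (Submodule.smul_mem _ _ (Submodule.subset_span ⟨a, rfl, rfl⟩)))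
  | succ N ih =>
    have hN := hgen.mono N.le_succ
    have hself : chainEigenvector p w x N (Fin.tail a)
        ∈ weightSpan p w x N (minusCount (Fin.tail a)) := Submodule.subset_span ⟨_, rfl, rfl⟩
    obtain ⟨_, hαβ, γ, hγ, hsum⟩ := Submodule.mem_sup.mp (ih hN (Fin.tail a))
    obtain ⟨α, hα, β, hβ, rfl⟩ := Submodule.mem_sup.mp hαβ
    rw [chain, chainEigenvector, Matrix.add_mulVec, siteTensor_mulVec, siteTensor_mulVec,
      Matrix.one_mulVec, ← hsum, map_add, map_add, minusCount_succ]
    generalize chainEigenvector p w x N (Fin.tail a) = v at *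
    generalize minusCount (Fin.tail a) = m at *
    generalize a 0 = e
    have hX := siteVec_mem_weightSpan hp hw hx hN
      (X.mulVec (siteEigenvector w (spectralParam p x N m) e)) hself
    have hβ' := siteVec_mem_weightSpan hp hw hx hN
      ((diagTwo p⁻¹ p).mulVec (siteEigenvector w (spectralParam p x N m) e)) hβ
    have hα' := siteVec_mem_weightSpan hp hw hx hN
      ((diagTwo p⁻¹ p).mulVec (siteEigenvector w (spectralParam p x N m) e)) hα
    have hγ' := siteVec_mem_weightSpan hp hw hx hN
      ((diagTwo p⁻¹ p).mulVec (siteEigenvector w (spectralParam p x N m) e)) hγ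
    fin_cases e
    · have h0 : (diagTwo p⁻¹ p).mulVec (siteEigenvector w (spectralParam p x N m) 0)
          = p • siteEigenvector w (spectralParam p x N (m + 1)) 0 := by
        rw [spectralParam_add_one hp]
        ext i
        fin_cases i <;> simp [siteEigenvector, diagTwo, Matrix.mulVec, dotProduct]
        field_simp
      have hγ'' : siteVec ((diagTwo p⁻¹ p).mulVec
          (siteEigenvector w (spectralParam p x N m) 0)) γ
          ∈ weightSpan p w x (N + 1) (m + 1) := by
        rw [h0, map_smul]
        exact Submodule.smul_mem _ _ (siteVec_zero_mem_weightSpan hγ)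
      simp only [Fin.zero_eta, Fin.isValue, zero_add, sub_add_cancel] at hX hβ' hα' ⊢
      refine Submodule.add_mem _ ?_ (Submodule.add_mem _ (Submodule.add_mem _ ?_ ?_) ?_)
      · exact SetLike.le_def.mp (sup_le_sup_right le_sup_right _) hX
      · exact Submodule.mem_sup_left hα'
      · exact SetLike.le_def.mp (sup_le_sup_right le_sup_right _) hβ'
      · exact Submodule.mem_sup_right hγ''
    · have h0 : (diagTwo p⁻¹ p).mulVec (siteEigenvector w (spectralParam p x N m) 1)
          = p • siteEigenvector w (spectralParam p x N (m - 1)) 1 := by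
        rw [spectralParam_sub_one hp]
        ext i
        fin_cases i <;> simp [siteEigenvector, diagTwo, Matrix.mulVec, dotProduct]
        field_simp
      have hα'' : siteVec ((diagTwo p⁻¹ p).mulVec
          (siteEigenvector w (spectralParam p x N m) 1)) α
          ∈ weightSpan p w x (N + 1) m := by
        rw [h0, map_smul]
        simpa using Submodule.smul_mem _ p (siteVec_one_mem_weightSpan hα)
      have hm : ((1 + m : ℕ) : ℤ) = (m : ℤ) + 1 := by push_cast; ring
      simp only [Fin.mk_one, Fin.isValue] at hX hβ' hγ' ⊢
      rw [hm, add_sub_cancel_right]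
      refine Submodule.add_mem _ ?_ (Submodule.add_mem _ (Submodule.add_mem _ ?_ ?_) ?_)
      · exact Submodule.mem_sup_left hX
      · exact Submodule.mem_sup_left (Submodule.mem_sup_left hα'')
      · exact Submodule.mem_sup_left hβ'
      · exact SetLike.le_def.mp (sup_le_sup_right le_sup_right _) hγ'

end Eigenbasis

/-! ### Standard orderings from eigenbases -/

section StandardOrdering

variable {K V ι : Type*} [Field K] [AddCommGroup V] [Module K V]

theorem eigenspace_eq_span_image_basis {A : Module.End K V} (b : Module.Basis ι K V) {μ : ι → K}
    (hA : ∀ i, A (b i) = μ i • b i) (ν : K) :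
    A.eigenspace ν = Submodule.span K (b '' {i | μ i = ν}) := by
  have hcoord : ∀ v i, b.repr (A v) i = μ i * b.repr v i := by
    intro v i
    have : (b.coord i) ∘ₗ A = μ i • b.coord i := by
      refine b.ext fun j => ?_
      by_cases h : j = i
      · subst h; simp [hA]
      · simp [hA, Finsupp.single_eq_of_ne' h]
    simpa using LinearMap.congr_fun this v
  ext v
  rw [Module.End.mem_eigenspace_iff, b.mem_span_image]
  constructor
  · intro h i hi
    have := hcoord v i
    rw [h, map_smul, Finsupp.smul_apply, smul_eq_mul] at this
    exact (mul_right_cancel₀ (Finsupp.mem_support_iff.mp hi) this).symm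
  · intro h
    refine b.repr.injective (Finsupp.ext fun i => ?_)
    rw [hcoord, map_smul, Finsupp.smul_apply, smul_eq_mul]
    by_cases hi : b.repr v i = 0
    · simp [hi]
    · rw [show μ i = ν from h (Finsupp.mem_support_iff.mpr hi)]

/-- A basis of eigenvectors of `A` that is graded by `0, …, d` according to the eigenvalues, and
with respect to which `B` changes the degree by at most one, gives a standard ordering. -/
theorem isStandardOrdering_of_eigenbasis [Fintype ι] {A B : Module.End K V}
    (b : Module.Basis ι K V) {d : ℕ} (m : ι → Fin (d + 1)) (hm : Function.Surjective m)
    {l : Fin (d + 1) → K} (hl : Function.Injective l) (hA : ∀ i, A (b i) = l (m i) • b i)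
    (hB : ∀ i, B (b i) ∈ Submodule.span K
      (b '' {j | (m j : ℕ) ≤ (m i : ℕ) + 1 ∧ (m i : ℕ) ≤ (m j : ℕ) + 1})) :
    IsDiagonalizable A ∧ ∃ U : Fin (d + 1) → Submodule K V, IsStandardOrdering A B U ∧
      ∀ n, Module.finrank K (U n) = (Finset.univ.filter fun i => m i = n).card := by
  have heig : ∀ n, A.eigenspace (l n) = Submodule.span K (b '' {i | m i = n}) := fun n => by
    rw [eigenspace_eq_span_image_basis b hA]; simp only [hl.eq_iff]
  have hval : ∀ n, A.HasEigenvalue (l n) := fun n => by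
    obtain ⟨i, rfl⟩ := hm n
    exact Module.End.hasEigenvalue_of_hasEigenvector (x := b i)
      ⟨Module.End.mem_eigenspace_iff.mpr (hA i), b.ne_zero i⟩
  refine ⟨?_, fun n => A.eigenspace (l n), ⟨⟨?_, ?_⟩, ?_⟩, ?_⟩
  · refine top_le_iff.mp ?_
    rw [← b.span_eq, Submodule.span_le]
    rintro _ ⟨i, rfl⟩
    exact Submodule.mem_iSup_of_mem (l (m i)) (Module.End.mem_eigenspace_iff.mpr (hA i))
  · intro n n' h
    obtain ⟨v, hv⟩ := (hval n).exists_hasEigenvector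
    have h1 := hv.apply_eq_smul
    have h2 : A v = l n' • v := Module.End.mem_eigenspace_iff.mp
      ((show A.eigenspace (l n) = A.eigenspace (l n') from h) ▸ hv.1)
    exact hl (smul_left_injective K hv.2 (h1.symm.trans h2))
  · ext W
    constructor
    · rintro ⟨n, rfl⟩
      exact ⟨l n, hval n, rfl⟩
    · rintro ⟨μ, hμ, rfl⟩
      by_cases h : ∃ n, l n = μ
      · obtain ⟨n, rfl⟩ := h
        exact ⟨n, rfl⟩
      · refine absurd ?_ hμ
        change A.eigenspace μ = ⊥
        rw [eigenspace_eq_span_image_basis b hA,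
          show {i | l (m i) = μ} = ∅ from Set.eq_empty_of_forall_notMem fun i hi => h ⟨_, hi⟩]
        simp
  · intro n
    simp only [heig]
    rw [Submodule.map_span_le]
    rintro _ ⟨i, rfl, rfl⟩
    refine SetLike.le_def.mp (Submodule.span_le.mpr ?_) (hB i)
    rintro _ ⟨j, hj, rfl⟩
    exact Submodule.mem_iSup_of_mem ⟨m j, hj⟩ (Submodule.subset_span ⟨j, rfl, rfl⟩)
  · intro n
    have hli : LinearIndependent K fun i : {i // m i = n} => b i :=
      b.linearIndependent.comp _ Subtype.val_injective
    change Module.finrank K (A.eigenspace (l n)) = _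
    rw [heig, show b '' {i | m i = n} = Set.range fun i : {i // m i = n} => b i by ext; simp,
      finrank_span_eq_card hli, Fintype.card_subtype]

theorem card_minusCount_eq (N n : ℕ) :
    (Finset.univ.filter fun a : Fin N → Fin 2 => minusCount a = n).card = N.choose n := by
  rw [Finset.card_filter]
  induction N generalizing n with
  | zero => cases n <;> simp [minusCount]
  | succ N ih =>
    rw [sum_spin_succ, Fin.sum_univ_two]
    simp only [minusCount_succ, Fin.cons_zero, Fin.tail_cons, Fin.val_zero, Fin.val_one, zero_add]
    cases n with
    | zero => simp [ih]
    | succ n => simp only [add_comm 1, add_left_inj, ih]; rw [Nat.choose_succ_succ, add_comm]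

theorem exists_minusCount_eq {N n : ℕ} (hn : n ≤ N) : ∃ a : Fin N → Fin 2, minusCount a = n := by
  have h := card_minusCount_eq N n
  have : 0 < (Finset.univ.filter fun a : Fin N → Fin 2 => minusCount a = n).card := by
    rw [h]; exact Nat.choose_pos hn
  obtain ⟨a, ha⟩ := Finset.card_pos.mp this
  exact ⟨a, (Finset.mem_filter.mp ha).2⟩

theorem eq_or_mul_eq_one_of_add_inv_eq {z z' : ℂ} (hz : z ≠ 0) (hz' : z' ≠ 0)
    (h : z + z⁻¹ = z' + z'⁻¹) :
    z = z' ∨ z * z' = 1 := by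
  have : (z - z') * (z * z' - 1) = 0 := by
    field_simp at h
    linear_combination h
  rcases mul_eq_zero.mp this with h | h
  · exact Or.inl (sub_eq_zero.mp h)
  · exact Or.inr (sub_eq_zero.mp h)

theorem exists_isStandardOrdering_chain {p w x : ℂ} (hp : p ≠ 0)
    (hq : ∀ k : ℕ, 1 ≤ k → p ^ (2 * k) ≠ 1) (hw : w ≠ 0) (hx : x ≠ 0) {N : ℕ}
    (hgen : IsGenericParam p x N) (c : ℂ) :
    IsDiagonalizable (Matrix.toLin' (chain (spinX p w) (diagTwo p p⁻¹) ((x + x⁻¹) / 2) N)) ∧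
    ∃ U : Fin (N + 1) → Submodule ℂ ((Fin N → Fin 2) → ℂ),
      IsStandardOrdering (Matrix.toLin' (chain (spinX p w) (diagTwo p p⁻¹) ((x + x⁻¹) / 2) N))
        (Matrix.toLin' (chain (spinX p w) (diagTwo p⁻¹ p) c N)) U ∧
      ∀ n, Module.finrank ℂ (U n) = N.choose n := by
  have hq' : ∀ j : ℤ, p ^ (2 * j) = 1 → j = 0 := by
    intro j hj
    by_contra h0
    refine hq j.natAbs (by omega) ?_
    rcases Int.natAbs_eq j with h | h
    · rw [h] at hj; exact_mod_cast hj
    · rw [h, mul_neg, zpow_neg, inv_eq_one] at hj; exact_mod_cast hj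
  have hspan := span_chainEigenvector hp hw hx hgen
  let b : Module.Basis (Fin N → Fin 2) ℂ ((Fin N → Fin 2) → ℂ) :=
    basisOfTopLeSpanOfCardEqFinrank (chainEigenvector p w x N) hspan.ge (by simp)
  have hb : ∀ a, b a = chainEigenvector p w x N a := fun a => by
    simp [b]
  let m : (Fin N → Fin 2) → Fin (N + 1) := fun a =>
    ⟨minusCount a, Nat.lt_succ_of_le (minusCount_le a)⟩
  let l : Fin (N + 1) → ℂ := fun n =>
    (spectralParam p x N (n : ℕ) + (spectralParam p x N (n : ℕ))⁻¹) / 2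
  have hm : Function.Surjective m := fun n => by
    obtain ⟨a, ha⟩ := exists_minusCount_eq (Nat.le_of_lt_succ n.2)
    exact ⟨a, Fin.ext ha⟩
  have hl : Function.Injective l := by
    intro n n' h
    have h' : spectralParam p x N (n : ℕ) + (spectralParam p x N (n : ℕ))⁻¹
        = spectralParam p x N (n' : ℕ) + (spectralParam p x N (n' : ℕ))⁻¹ := by
      simpa [l, div_left_inj'] using h
    rcases eq_or_mul_eq_one_of_add_inv_eq (spectralParam_ne_zero hp hx _ _)
      (spectralParam_ne_zero hp hx _ _) h'
      with h1 | h1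
    · rw [spectralParam, spectralParam, mul_right_inj' hx] at h1
      have h2 : p ^ (2 * ((n' : ℤ) - n)) = 1 := by
        have : (2 : ℤ) * (n' - n) = (N - 2 * n) - (N - 2 * n') := by ring
        rw [this, zpow_sub₀ hp]
        exact (div_eq_one_iff_eq (zpow_ne_zero _ hp)).mpr h1
      have := hq' _ h2
      exact Fin.ext (by omega)
    · refine absurd ?_ (hgen (N - n - n') (abs_le.mpr ⟨by omega, by omega⟩))
      rw [← h1, spectralParam, spectralParam, mul_mul_mul_comm, ← zpow_add₀ hp, sq]
      congr 2; ring
  obtain ⟨h1, U, h2, h3⟩ := isStandardOrdering_of_eigenbasis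
    (A := Matrix.toLin' (chain (spinX p w) (diagTwo p p⁻¹) ((x + x⁻¹) / 2) N))
    (B := Matrix.toLin' (chain (spinX p w) (diagTwo p⁻¹ p) c N)) b m hm hl
    (fun a => by rw [hb, Matrix.toLin'_apply]; exact chain_mulVec_chainEigenvector hp hw hx N a)
    (fun a => by
      rw [hb, Matrix.toLin'_apply]
      have hle : ∀ k : ℤ, (k ≤ minusCount a + 1 ∧ minusCount a ≤ k + 1) →
          weightSpan p w x N k ≤ Submodule.span ℂ
            (b '' {j | (m j : ℕ) ≤ (m a : ℕ) + 1 ∧ (m a : ℕ) ≤ (m j : ℕ) + 1}) := by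
        intro k hk
        refine Submodule.span_mono ?_
        rintro _ ⟨j, hj, rfl⟩
        refine ⟨j, ?_, hb j⟩
        simp only [Set.mem_ofPred_eq, m] at hj ⊢
        omega
      exact sup_le (sup_le (hle _ (by omega)) (hle _ (by omega))) (hle _ (by omega))
        (chain_mulVec_mem_weightSpan hp hw hx _ c hgen a))
  refine ⟨h1, U, h2, fun n => ?_⟩
  rw [h3, ← card_minusCount_eq]
  simp only [m, Fin.ext_iff]

end StandardOrdering

/-! ### Generation of the full matrix algebra is a Zariski open condition -/

section Spread

variable {n ι R : Type*} [Fintype n] [DecidableEq n]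

theorem subalgebra_eq_top_of_det_ne_zero {K : Type*} [Field K] (S : Subalgebra K (Matrix n n K))
    (Y : n × n → Matrix n n K) (hY : ∀ i, Y i ∈ S)
    (hdet : (Matrix.of fun i j : n × n => Y i j.1 j.2).det ≠ 0) : S = ⊤ := by
  set Q : Matrix (n × n) (n × n) K := Matrix.of fun i j : n × n => Y i j.1 j.2
  refine (Algebra.eq_top_iff).mpr fun Z => ?_
  have hQ : IsUnit Q.det := isUnit_iff_ne_zero.mpr hdet
  have hZ : Z = ∑ i, (Matrix.vecMul (fun j : n × n => Z j.1 j.2) Q⁻¹) i • Y i := by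
    ext a b
    have h : Matrix.vecMul (Matrix.vecMul (fun j : n × n => Z j.1 j.2) Q⁻¹) Q (a, b) = Z a b := by
      rw [Matrix.vecMul_vecMul, Matrix.nonsing_inv_mul _ hQ, Matrix.vecMul_one]
    rw [← h, Matrix.sum_apply]
    rfl
  rw [hZ]
  exact Subalgebra.sum_mem _ fun i _ => Subalgebra.smul_mem _ (hY i) _

/-- If a family of matrices over a `K`-algebra `R` generates the full matrix algebra after the
specialization `e₀ : R → K`, then it does so after every specialization at which a certain element
`D` of `R` with `e₀ D ≠ 0` does not vanish: `D` is the determinant of words that specialize to the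
matrix units. -/
theorem exists_ne_zero_adjoin_eq_top {K : Type*} [Field K] [CommRing R] [Algebra K R]
    (g : ι → Matrix n n R) (e₀ : R →ₐ[K] K)
    (h : Algebra.adjoin K (Set.range fun i => (g i).map e₀) = ⊤) :
    ∃ D : R, e₀ D ≠ 0 ∧ ∀ e : R →ₐ[K] K, e D ≠ 0 →
      Algebra.adjoin K (Set.range fun i => (g i).map e) = ⊤ := by
  have hlift : ∀ (e : R →ₐ[K] K) (f : FreeAlgebra K ι),
      (FreeAlgebra.lift K g f).map e = FreeAlgebra.lift K (fun i => (g i).map e) f := by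
    intro e f
    have : e.mapMatrix.comp (FreeAlgebra.lift K g)
        = FreeAlgebra.lift K (fun i => (g i).map e) := by
      ext i : 2; simp
    exact AlgHom.congr_fun this f
  have hunit : ∀ i : n × n, ∃ f : FreeAlgebra K ι,
      FreeAlgebra.lift K (fun i => (g i).map e₀) f = Matrix.single i.1 i.2 1 := by
    intro i
    have : Matrix.single i.1 i.2 (1 : K) ∈ Algebra.adjoin K (Set.range fun i => (g i).map e₀) := by
      rw [h]; trivial
    rwa [Algebra.adjoin_range_eq_range_freeAlgebra_lift] at this
  choose f hf using hunit
  have hdet : ∀ e : R →ₐ[K] K,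
      e (Matrix.of fun i j : n × n => FreeAlgebra.lift K g (f i) j.1 j.2).det
        = (Matrix.of fun i j : n × n =>
            FreeAlgebra.lift K (fun i => (g i).map e) (f i) j.1 j.2).det := by
    intro e
    rw [AlgHom.map_det]
    congr 1
    ext i j
    simp only [← hlift, AlgHom.mapMatrix_apply, Matrix.map_apply, Matrix.of_apply]
  refine ⟨(Matrix.of fun i j : n × n => FreeAlgebra.lift K g (f i) j.1 j.2).det, ?_, ?_⟩
  · rw [hdet]
    have : (Matrix.of fun i j : n × n =>
        FreeAlgebra.lift K (fun i => (g i).map e₀) (f i) j.1 j.2) = 1 := by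
      ext i j
      rw [Matrix.of_apply, hf, Matrix.single_apply, Matrix.one_apply]
      simp only [Prod.ext_iff]
    rw [this, Matrix.det_one]
    exact one_ne_zero
  · intro e he
    rw [hdet] at he
    refine subalgebra_eq_top_of_det_ne_zero _ _ (fun i => ?_) he
    rw [Algebra.adjoin_range_eq_range_freeAlgebra_lift]
    exact ⟨f i, rfl⟩

end Spread

/-! ### The algebra at infinity -/

section Limit

variable {N : ℕ}

/-- The eigenvalue `p^{s-1} - p^{1-s}`, `s = N - 2n`, of `limitDiag` on the configurations with
`n` minus signs. -/
noncomputable def ladderWeight (p : ℂ) (N : ℕ) (n : ℤ) : ℂ :=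
  p ^ ((N : ℤ) - 2 * n - 1) - p ^ (1 - ((N : ℤ) - 2 * n))

/-- The diagonal operator `p⁻¹ q^{σ₃/2} ⊗ ⋯ ⊗ q^{σ₃/2} - p q^{-σ₃/2} ⊗ ⋯ ⊗ q^{-σ₃/2}`. -/
noncomputable def limitDiag (p : ℂ) (N : ℕ) : Matrix (Fin N → Fin 2) (Fin N → Fin 2) ℂ :=
  chain (offDiag 0 0) (diagTwo p p⁻¹) p⁻¹ N + chain (offDiag 0 0) (diagTwo p⁻¹ p) (-p) N

/-- The four generators of the limit algebra: the leading terms of the two chains, and of their two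
`q`-commutators. -/
noncomputable def limitGen (p : ℂ) (N : ℕ) :
    Fin 4 → Matrix (Fin N → Fin 2) (Fin N → Fin 2) ℂ :=
  ![chain (offDiag 0 0) (diagTwo p p⁻¹) p⁻¹ N, chain (offDiag 0 0) (diagTwo p⁻¹ p) (-p) N,
    ladder (offDiag 1 0) (limitDiag p) N, ladder (offDiag 0 1) (limitDiag p) N]

theorem offDiag_zero {R : Type*} [CommRing R] : offDiag (0 : R) 0 = 0 := by
  ext i j; fin_cases i <;> fin_cases j <;> rfl

theorem chain_zero_eq_diagonal {p : ℂ} (hp : p ≠ 0) (c : ℂ) (N : ℕ) :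
    chain (offDiag 0 0) (diagTwo p p⁻¹) c N
      = Matrix.diagonal fun a => c * p ^ ((N : ℤ) - 2 * minusCount a) := by
  induction N with
  | zero => ext a b; simp [chain, Matrix.one_apply, Matrix.diagonal_apply, minusCount]
  | succ N ih =>
    rw [chain, ih, offDiag_zero, siteTensor_zero_left, zero_add]
    ext a b
    by_cases hab : a = b
    · subst hab
      rw [Matrix.diagonal_apply_eq, minusCount_succ, siteTensor, Matrix.of_apply,
        Matrix.diagonal_apply_eq]
      generalize a 0 = e
      have h1 : ((N + 1 : ℕ) : ℤ) - 2 * ((0 + minusCount (Fin.tail a) : ℕ) : ℤ)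
        = (N - 2 * (minusCount (Fin.tail a) : ℤ)) + 1 := by push_cast; ring
      have h2 : ((N + 1 : ℕ) : ℤ) - 2 * ((1 + minusCount (Fin.tail a) : ℕ) : ℤ)
        = (N - 2 * (minusCount (Fin.tail a) : ℤ)) - 1 := by push_cast; ring
      fin_cases e
      · simp only [Fin.zero_eta]
        rw [h1, zpow_add_one₀ hp]; simp [diagTwo]; ring
      · simp only [Fin.mk_one]
        rw [h2, zpow_sub_one₀ hp]; simp [diagTwo]; ring
    · rw [Matrix.diagonal_apply_ne _ hab, siteTensor, Matrix.of_apply]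
      by_cases ht : Fin.tail a = Fin.tail b
      · have h0 : a 0 ≠ b 0 := fun h0 => hab (by
          rw [← Fin.cons_self_tail a, ← Fin.cons_self_tail b, h0, ht])
        have : ∀ e e' : Fin 2, e ≠ e' → diagTwo p p⁻¹ e e' = 0 := by
          intro e e' h; fin_cases e <;> fin_cases e' <;> simp_all [diagTwo]
        rw [this _ _ h0, zero_mul]
      · rw [Matrix.diagonal_apply_ne _ ht, mul_zero]

theorem limitDiag_eq_diagonal {p : ℂ} (hp : p ≠ 0) (N : ℕ) :
    limitDiag p N = Matrix.diagonal fun a => ladderWeight p N (minusCount a) := by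
  have h := chain_zero_eq_diagonal (inv_ne_zero hp) (-p) N
  rw [inv_inv] at h
  rw [limitDiag, chain_zero_eq_diagonal hp, h, Matrix.diagonal_add]
  congr 1
  ext a
  rw [ladderWeight, zpow_sub_one₀ hp, sub_eq_add_neg (1 : ℤ), zpow_add₀ hp, inv_zpow', zpow_one]
  ring

/-- The vector `f₊ ⊗ ⋯ ⊗ f₊`. -/
def allPlus (N : ℕ) : (Fin N → Fin 2) → ℂ := Pi.single 0 1

/-- The vector `f₋ ⊗ ⋯ ⊗ f₋`. -/
def allMinus (N : ℕ) : (Fin N → Fin 2) → ℂ := Pi.single 1 1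

theorem eq_const_iff (N : ℕ) (e : Fin 2) (a : Fin (N + 1) → Fin 2) :
    (a = fun _ => e) ↔ a 0 = e ∧ Fin.tail a = fun _ => e := by
  constructor
  · rintro rfl; exact ⟨rfl, rfl⟩
  · rintro ⟨h0, h⟩
    rw [← Fin.cons_self_tail a, h0, h]
    funext i
    refine Fin.cases ?_ (fun _ => ?_) i <;> simp

theorem allPlus_succ (N : ℕ) : allPlus (N + 1) = siteVec ![1, 0] (allPlus N) := by
  ext a
  have := eq_const_iff N 0 a
  simp only [allPlus, siteVec_apply, Pi.single_apply]
  change (if a = fun _ => 0 then (1 : ℂ) else 0) = _ * if Fin.tail a = fun _ => 0 then 1 else 0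
  simp only [this]
  generalize a 0 = e
  fin_cases e <;> simp

theorem allMinus_succ (N : ℕ) : allMinus (N + 1) = siteVec ![0, 1] (allMinus N) := by
  ext a
  have := eq_const_iff N 1 a
  simp only [allMinus, siteVec_apply, Pi.single_apply]
  change (if a = fun _ => 1 then (1 : ℂ) else 0) = _ * if Fin.tail a = fun _ => 1 then 1 else 0
  simp only [this]
  generalize a 0 = e
  fin_cases e <;> simp

theorem ladder_lower_mulVec (S : (N : ℕ) → Matrix (Fin N → Fin 2) (Fin N → Fin 2) ℂ)
    (v v' : (Fin N → Fin 2) → ℂ) :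
    (ladder (offDiag 0 1) S (N + 1)).mulVec (siteVec ![1, 0] v + siteVec ![0, 1] v')
      = siteVec ![1, 0] ((ladder (offDiag 0 1) S N).mulVec v)
        + siteVec ![0, 1] ((S N).mulVec v + (ladder (offDiag 0 1) S N).mulVec v') := by
  have h1 : (offDiag (0 : ℂ) 1).mulVec ![1, 0] = ![0, 1] := by
    ext i; fin_cases i <;> simp [offDiag]
  have h2 : (offDiag (0 : ℂ) 1).mulVec ![0, 1] = 0 := by
    ext i; fin_cases i <;> simp [offDiag]
  rw [ladder, Matrix.add_mulVec, Matrix.mulVec_add, Matrix.mulVec_add]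
  simp only [siteTensor_mulVec, h1, h2, map_zero, LinearMap.zero_apply, map_add, Matrix.one_mulVec]
  abel

theorem ladder_raise_mulVec (S : (N : ℕ) → Matrix (Fin N → Fin 2) (Fin N → Fin 2) ℂ)
    (v v' : (Fin N → Fin 2) → ℂ) :
    (ladder (offDiag 1 0) S (N + 1)).mulVec (siteVec ![1, 0] v + siteVec ![0, 1] v')
      = siteVec ![1, 0] ((S N).mulVec v' + (ladder (offDiag 1 0) S N).mulVec v)
        + siteVec ![0, 1] ((ladder (offDiag 1 0) S N).mulVec v') := by
  have h1 : (offDiag (1 : ℂ) 0).mulVec ![1, 0] = 0 := by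
    ext i; fin_cases i <;> simp [offDiag]
  have h2 : (offDiag (1 : ℂ) 0).mulVec ![0, 1] = ![1, 0] := by
    ext i; fin_cases i <;> simp [offDiag]
  rw [ladder, Matrix.add_mulVec, Matrix.mulVec_add, Matrix.mulVec_add]
  simp only [siteTensor_mulVec, h1, h2, map_zero, LinearMap.zero_apply, map_add, Matrix.one_mulVec]
  abel

end Limit

section LimitAlgebra

theorem ladder_lower_apply_ne_zero {p : ℂ} (hp : p ≠ 0) {N : ℕ} {a b : Fin N → Fin 2}
    (h : ladder (offDiag 0 1) (limitDiag p) N a b ≠ 0) : minusCount a = minusCount b + 1 := by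
  induction N with
  | zero => simp [ladder] at h
  | succ N ih =>
    have hsplit : ladder (offDiag 0 1) (limitDiag p) (N + 1) a b
        = offDiag 0 1 (a 0) (b 0) * limitDiag p N (Fin.tail a) (Fin.tail b)
          + (1 : Matrix (Fin 2) (Fin 2) ℂ) (a 0) (b 0)
            * ladder (offDiag 0 1) (limitDiag p) N (Fin.tail a) (Fin.tail b) := rfl
    rw [hsplit] at h
    rw [minusCount_succ, minusCount_succ]
    by_cases h0 : a 0 = b 0
    · have : ∀ e : Fin 2, offDiag (0 : ℂ) 1 e e = 0 := by intro e; fin_cases e <;> rfl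
      rw [h0, this, zero_mul, zero_add, Matrix.one_apply_eq, one_mul] at h
      rw [h0, ih h, add_assoc]
    · rw [Matrix.one_apply_ne h0, zero_mul, add_zero] at h
      have h1 := left_ne_zero_of_mul h
      have h2 := right_ne_zero_of_mul h
      have ht : Fin.tail a = Fin.tail b := by
        by_contra hne
        rw [limitDiag_eq_diagonal hp, Matrix.diagonal_apply_ne _ hne] at h2
        exact h2 rfl
      have : ∀ e e' : Fin 2, offDiag (0 : ℂ) 1 e e' ≠ 0 → (e : ℕ) = e' + 1 := by
        intro e e'; fin_cases e <;> fin_cases e' <;> simp [offDiag]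
      rw [ht, this _ _ h1]
      ring

theorem ladder_lower_mulVec_support {p : ℂ} (hp : p ≠ 0) {N n : ℕ} {v : (Fin N → Fin 2) → ℂ}
    (hv : ∀ a, v a ≠ 0 → minusCount a = n) (a : Fin N → Fin 2)
    (ha : (ladder (offDiag 0 1) (limitDiag p) N).mulVec v a ≠ 0) : minusCount a = n + 1 := by
  obtain ⟨b, -, hb⟩ := Finset.exists_ne_zero_of_sum_ne_zero ha
  rw [ladder_lower_apply_ne_zero hp (left_ne_zero_of_mul hb), hv b (right_ne_zero_of_mul hb)]

theorem minusCount_zero (N : ℕ) : minusCount (0 : Fin N → Fin 2) = 0 := by simp [minusCount]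

theorem minusCount_one (N : ℕ) : minusCount (1 : Fin N → Fin 2) = N := by simp [minusCount]

theorem eq_zero_of_minusCount_eq_zero {N : ℕ} {a : Fin N → Fin 2} (h : minusCount a = 0) :
    a = 0 := by
  funext i
  have := (Finset.sum_eq_zero_iff.mp h) i (Finset.mem_univ i)
  exact Fin.ext this

theorem ladder_lower_pow_support {p : ℂ} (hp : p ≠ 0) (N j : ℕ) (a : Fin N → Fin 2)
    (ha : (ladder (offDiag 0 1) (limitDiag p) N ^ j).mulVec (allPlus N) a ≠ 0) :
    minusCount a = j := by
  induction j generalizing a with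
  | zero =>
    rw [pow_zero, Matrix.one_mulVec, allPlus, Pi.single_apply] at ha
    have : a = 0 := by by_contra h; simp [h] at ha
    rw [this, minusCount_zero]
  | succ j ih =>
    rw [pow_succ', ← Matrix.mulVec_mulVec] at ha
    exact ladder_lower_mulVec_support hp ih a ha

theorem limitDiag_mulVec {p : ℂ} (hp : p ≠ 0) {N n : ℕ} {v : (Fin N → Fin 2) → ℂ}
    (hv : ∀ a, v a ≠ 0 → minusCount a = n) :
    (limitDiag p N).mulVec v = ladderWeight p N n • v := by
  rw [limitDiag_eq_diagonal hp]
  ext a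
  rw [Matrix.mulVec_diagonal, Pi.smul_apply, smul_eq_mul]
  by_cases ha : v a = 0
  · simp [ha]
  · rw [hv a ha]

theorem ladder_lower_mulVec_allMinus {p : ℂ} (hp : p ≠ 0) (N : ℕ) :
    (ladder (offDiag 0 1) (limitDiag p) N).mulVec (allMinus N) = 0 := by
  by_contra h
  obtain ⟨a, ha⟩ := Function.ne_iff.mp h
  have h1 := ladder_lower_mulVec_support hp (n := N) (fun b hb => by
    have : b = 1 := by by_contra h; simp [allMinus, h] at hb
    rw [this, minusCount_one]) a ha
  have := minusCount_le a
  omega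

theorem ladder_lower_pow_mulVec {p : ℂ} (hp : p ≠ 0) (N m : ℕ) :
    (ladder (offDiag 0 1) (limitDiag p) (N + 1) ^ (m + 1)).mulVec (allPlus (N + 1))
      = siteVec ![1, 0] ((ladder (offDiag 0 1) (limitDiag p) N ^ (m + 1)).mulVec (allPlus N))
        + siteVec ![0, 1] ((∑ j ∈ Finset.range (m + 1), ladderWeight p N j) •
          (ladder (offDiag 0 1) (limitDiag p) N ^ m).mulVec (allPlus N)) := by
  induction m with
  | zero =>
    have := ladder_lower_mulVec (limitDiag p) (allPlus N) 0
    rw [map_zero, add_zero, Matrix.mulVec_zero, add_zero] at this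
    rw [zero_add, pow_one, allPlus_succ, this, limitDiag_mulVec hp (n := 0)
      (fun a ha => ladder_lower_pow_support hp N 0 a (by simpa using ha))]
    simp
  | succ m ih =>
    rw [pow_succ', ← Matrix.mulVec_mulVec, ih, ladder_lower_mulVec, Matrix.mulVec_smul,
      Matrix.mulVec_mulVec _ (ladder _ _ _), ← pow_succ', Matrix.mulVec_mulVec _ (ladder _ _ _),
      ← pow_succ', limitDiag_mulVec hp (ladder_lower_pow_support hp N (m + 1)), ← add_smul,
      Finset.sum_range_succ _ (m + 1), add_comm (ladderWeight _ _ _)]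

/-- The weights of all configurations but the lowest add up to zero: they are antisymmetric under
`n ↦ N - 1 - n`. This is what the choice of the ratio `-p⁻²` of the two leading coefficients in
`limitDiag` achieves. -/
theorem sum_ladderWeight (p : ℂ) (N : ℕ) : ∑ j ∈ Finset.range N, ladderWeight p N j = 0 := by
  have h : ∑ j ∈ Finset.range N, ladderWeight p N j
      = -∑ j ∈ Finset.range N, ladderWeight p N j := by
    rw [← Finset.sum_neg_distrib, ← Finset.sum_range_reflect]
    refine Finset.sum_congr rfl fun j hj => ?_
    have hj' := Finset.mem_range.mp hj
    have hc : ((N - 1 - j : ℕ) : ℤ) = N - 1 - j := by omega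
    rw [ladderWeight, ladderWeight, hc, neg_sub]
    congr 2 <;> ring
  linear_combination h / 2

theorem ladderWeight_self_ne_zero {p : ℂ} (hp : p ≠ 0)
    (hq : ∀ k : ℕ, 1 ≤ k → p ^ (2 * k) ≠ 1) (N : ℕ) : ladderWeight p N N ≠ 0 := by
  intro h
  refine hq (N + 1) (by omega) ?_
  have h1 := sub_eq_zero.mp h
  rw [show (N : ℤ) - 2 * (N : ℕ) - 1 = -((N + 1 : ℕ) : ℤ) by push_cast; ring,
    show 1 - ((N : ℤ) - 2 * (N : ℕ)) = ((N + 1 : ℕ) : ℤ) by push_cast; ring, zpow_neg,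
    zpow_natCast, inv_eq_iff_eq_inv] at h1
  rw [two_mul, pow_add]
  nth_rewrite 1 [h1]
  exact inv_mul_cancel₀ (pow_ne_zero _ hp)

/-- The `N`-th power of the lowering operator takes the highest to the lowest vector. -/
theorem exists_ladder_lower_pow_allPlus {p : ℂ} (hp : p ≠ 0)
    (hq : ∀ k : ℕ, 1 ≤ k → p ^ (2 * k) ≠ 1) (N : ℕ) :
    ∃ κ : ℂ, κ ≠ 0 ∧ (ladder (offDiag 0 1) (limitDiag p) N ^ N).mulVec (allPlus N)
      = κ • allMinus N := by
  induction N with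
  | zero =>
    refine ⟨1, one_ne_zero, ?_⟩
    rw [pow_zero, Matrix.one_mulVec, one_smul, allPlus, allMinus,
      Subsingleton.elim (0 : Fin 0 → Fin 2) 1]
  | succ N ih =>
    obtain ⟨κ, hκ, h⟩ := ih
    refine ⟨ladderWeight p N N * κ, mul_ne_zero (ladderWeight_self_ne_zero hp hq N) hκ, ?_⟩
    rw [ladder_lower_pow_mulVec hp, pow_succ', ← Matrix.mulVec_mulVec, h, Matrix.mulVec_smul,
      ladder_lower_mulVec_allMinus hp, smul_zero, map_zero, zero_add, Finset.sum_range_succ,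
      sum_ladderWeight, zero_add, smul_smul, map_smul, allMinus_succ]

/-- The `N`-th power of the lowering operator on `N + 1` sites flips all sites but the leftmost. -/
theorem ladder_lower_pow_allPlus_succ {p : ℂ} (hp : p ≠ 0) (N : ℕ) :
    (ladder (offDiag 0 1) (limitDiag p) (N + 1) ^ N).mulVec (allPlus (N + 1))
      = siteVec ![1, 0] ((ladder (offDiag 0 1) (limitDiag p) N ^ N).mulVec (allPlus N)) := by
  cases N with
  | zero => simp [allPlus_succ]
  | succ N => rw [ladder_lower_pow_mulVec hp, sum_ladderWeight, zero_smul, map_zero, add_zero]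

theorem limitDiag_transpose {p : ℂ} (hp : p ≠ 0) (N : ℕ) :
    (limitDiag p N).transpose = limitDiag p N := by
  rw [limitDiag_eq_diagonal hp, Matrix.diagonal_transpose]

theorem ladder_lower_transpose {p : ℂ} (hp : p ≠ 0) (N : ℕ) :
    (ladder (offDiag 0 1) (limitDiag p) N).transpose
      = ladder (offDiag 1 0) (limitDiag p) N := by
  simp only [ladder_transpose, limitDiag_transpose hp, offDiag_transpose]

/-- The transpose permutes the generators. -/
theorem exists_limitGen_transpose {p : ℂ} (hp : p ≠ 0) (N : ℕ) (i : Fin 4) :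
    ∃ j, (limitGen p N i).transpose = limitGen p N j := by
  fin_cases i
  · exact ⟨0, by simp [limitGen, chain_transpose, offDiag_transpose, diagTwo_transpose]⟩
  · exact ⟨1, by simp [limitGen, chain_transpose, offDiag_transpose, diagTwo_transpose]⟩
  · refine ⟨3, ?_⟩
    change (ladder (offDiag 1 0) (limitDiag p) N).transpose = ladder (offDiag 0 1) (limitDiag p) N
    rw [← ladder_lower_transpose hp, Matrix.transpose_transpose]
  · exact ⟨2, ladder_lower_transpose hp N⟩

/-- The projector onto the highest vector is a polynomial in the first generator. -/
theorem single_zero_mem_adjoin {p : ℂ} (hp : p ≠ 0) (hq : ∀ k : ℕ, 1 ≤ k → p ^ (2 * k) ≠ 1)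
    (N : ℕ) : Matrix.single 0 0 1 ∈ Algebra.adjoin ℂ (Set.range (limitGen p N)) := by
  set d : (Fin N → Fin 2) → ℂ := fun a => p⁻¹ * p ^ ((N : ℤ) - 2 * minusCount a) with hd
  set f : Polynomial ℂ := ∏ n ∈ Finset.Icc 1 N,
    (Polynomial.X - Polynomial.C (p⁻¹ * p ^ ((N : ℤ) - 2 * n)))
  have hA : limitGen p N 0 = Matrix.diagonalAlgHom ℂ d := chain_zero_eq_diagonal hp _ N
  have hf : Polynomial.aeval (limitGen p N 0) f = Matrix.diagonal fun a => f.eval (d a) := by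
    rw [hA, Polynomial.aeval_algHom_apply]
    change Matrix.diagonal _ = _
    congr 1
    funext a
    exact (Polynomial.aeval_algHom_apply (Pi.evalAlgHom ℂ (fun _ : Fin N → Fin 2 => ℂ) a) d f).symm
  have hzero : ∀ a, a ≠ 0 → f.eval (d a) = 0 := by
    intro a ha
    rw [Polynomial.eval_prod]
    refine Finset.prod_eq_zero (i := minusCount a) (Finset.mem_Icc.mpr ⟨?_, minusCount_le a⟩) ?_
    · exact Nat.one_le_iff_ne_zero.mpr fun h => ha (eq_zero_of_minusCount_eq_zero h)
    · simp [hd]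
  have hne : f.eval (d 0) ≠ 0 := by
    rw [Polynomial.eval_prod, Finset.prod_ne_zero_iff]
    intro n hn
    have hn1 := (Finset.mem_Icc.mp hn).1
    simp only [hd, minusCount_zero, Polynomial.eval_sub, Polynomial.eval_X, Polynomial.eval_C,
      Nat.cast_zero, mul_zero, sub_zero]
    rw [← mul_sub]
    refine mul_ne_zero (inv_ne_zero hp) (sub_ne_zero.mpr fun h => hq n hn1 ?_)
    rw [zpow_sub₀ hp, eq_div_iff (zpow_ne_zero _ hp)] at h
    have := mul_left_cancel₀ (zpow_ne_zero _ hp) (h.trans (mul_one _).symm)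
    exact_mod_cast this
  have hs : Matrix.single 0 0 1 = (f.eval (d 0))⁻¹ • Polynomial.aeval (limitGen p N 0) f := by
    rw [hf]
    ext a b
    rw [Matrix.smul_apply, Matrix.single_apply, Matrix.diagonal_apply]
    by_cases ha : a = 0
    · subst ha
      by_cases hb : b = 0
      · subst hb; simp [hne]
      · simp [Ne.symm hb]
    · simp [Ne.symm ha, hzero a ha]
  rw [hs]
  refine Subalgebra.smul_mem _ ?_ _
  exact Algebra.adjoin_mono (Set.singleton_subset_iff.mpr (Set.mem_range_self 0))
    (Polynomial.aeval_mem_adjoin_singleton ℂ _)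

/-- A subspace that is invariant under a family of matrices is invariant under the algebra generated
by it. -/
theorem mulVec_mem_of_mem_adjoin {n : Type*} [Fintype n] [DecidableEq n]
    {s : Set (Matrix n n ℂ)} {W : Submodule ℂ (n → ℂ)}
    (hW : ∀ Y ∈ s, ∀ v ∈ W, Y.mulVec v ∈ W) {Y : Matrix n n ℂ} (hY : Y ∈ Algebra.adjoin ℂ s) :
    ∀ v ∈ W, Y.mulVec v ∈ W := by
  induction hY using Algebra.adjoin_induction with
  | mem Y h => exact hW Y h
  | algebraMap r =>
    intro v hv
    rw [Algebra.algebraMap_eq_smul_one, Matrix.smul_mulVec, Matrix.one_mulVec]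
    exact W.smul_mem _ hv
  | add Y Z _ _ h1 h2 =>
    intro v hv
    rw [Matrix.add_mulVec]
    exact W.add_mem (h1 v hv) (h2 v hv)
  | mul Y Z _ _ h1 h2 =>
    intro v hv
    rw [← Matrix.mulVec_mulVec]
    exact h1 _ (h2 v hv)

/-- The highest vector is cyclic for the limit algebra. If `W` is an invariant subspace that
contains it, the vectors `v` with `ℂ² ⊗ v ⊆ W` form an invariant subspace `Z` of the shorter
chain; by the vanishing of `sum_ladderWeight`, the `N`-th and the next power of the lowering
operator show that `Z` contains the lowest vector, hence the highest one. -/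
theorem eq_top_of_allPlus_mem {p : ℂ} (hp : p ≠ 0) (hq : ∀ k : ℕ, 1 ≤ k → p ^ (2 * k) ≠ 1)
    (N : ℕ) (W : Submodule ℂ ((Fin N → Fin 2) → ℂ))
    (hW : ∀ i, ∀ v ∈ W, (limitGen p N i).mulVec v ∈ W) (hT : allPlus N ∈ W) : W = ⊤ := by
  induction N with
  | zero =>
    refine Submodule.eq_top_iff'.mpr fun v => ?_
    have : v = v 0 • allPlus 0 := by
      ext b; simp [allPlus, Subsingleton.elim b 0]
    rw [this]
    exact W.smul_mem _ hT
  | succ N ih =>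
    set Z : Submodule ℂ ((Fin N → Fin 2) → ℂ) :=
      W.comap (siteVec ![1, 0]) ⊓ W.comap (siteVec ![0, 1]) with hZdef
    have hZ : ∀ v, v ∈ Z ↔ siteVec ![1, 0] v ∈ W ∧ siteVec ![0, 1] v ∈ W := fun v => Iff.rfl
    have hdiag : ∀ (r : ℂ), r ≠ 0 → ∀ (c : ℂ),
        (∀ v ∈ W, (chain (offDiag 0 0) (diagTwo r r⁻¹) c (N + 1)).mulVec v ∈ W) →
        ∀ v ∈ Z, (chain (offDiag 0 0) (diagTwo r r⁻¹) c N).mulVec v ∈ Z := by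
      intro r hr c hinv v hv
      have h1 : (diagTwo r r⁻¹).mulVec ![1, 0] = r • ![1, 0] := by
        ext i; fin_cases i <;> simp [diagTwo]
      have h2 : (diagTwo r r⁻¹).mulVec ![0, 1] = r⁻¹ • ![0, 1] := by
        ext i; fin_cases i <;> simp [diagTwo]
      have e1 := hinv _ ((hZ v).mp hv).1
      have e2 := hinv _ ((hZ v).mp hv).2
      rw [chain, offDiag_zero, siteTensor_zero_left, zero_add, siteTensor_mulVec] at e1 e2
      rw [h1, map_smul, LinearMap.smul_apply, Submodule.smul_mem_iff _ hr] at e1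
      rw [h2, map_smul, LinearMap.smul_apply, Submodule.smul_mem_iff _ (inv_ne_zero hr)] at e2
      rw [offDiag_zero]
      exact (hZ _).mpr ⟨e1, e2⟩
    have hZ0 := hdiag p hp p⁻¹ (hW 0)
    have hZ1 := hdiag p⁻¹ (inv_ne_zero hp) (-p) (by rw [inv_inv]; exact hW 1)
    rw [inv_inv] at hZ1
    have hH : ∀ v ∈ Z, (limitDiag p N).mulVec v ∈ Z := by
      intro v hv
      rw [limitDiag, Matrix.add_mulVec]
      exact Z.add_mem (hZ0 v hv) (hZ1 v hv)
    have hZ2 : ∀ v ∈ Z, (ladder (offDiag 1 0) (limitDiag p) N).mulVec v ∈ Z := by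
      intro v hv
      have e1 : (ladder (offDiag 1 0) (limitDiag p) (N + 1)).mulVec _ ∈ W :=
        hW 2 _ ((hZ v).mp hv).1
      have e2 : (ladder (offDiag 1 0) (limitDiag p) (N + 1)).mulVec _ ∈ W :=
        hW 2 _ ((hZ v).mp hv).2
      have h1 := ladder_raise_mulVec (limitDiag p) v 0
      have h2 := ladder_raise_mulVec (limitDiag p) 0 v
      simp only [map_zero, add_zero, zero_add, Matrix.mulVec_zero] at h1 h2
      rw [h1] at e1
      rw [h2] at e2
      exact (hZ _).mpr ⟨e1, (W.add_mem_iff_right ((hZ _).mp (hH v hv)).1).mp e2⟩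
    have hZ3 : ∀ v ∈ Z, (ladder (offDiag 0 1) (limitDiag p) N).mulVec v ∈ Z := by
      intro v hv
      have e1 : (ladder (offDiag 0 1) (limitDiag p) (N + 1)).mulVec _ ∈ W :=
        hW 3 _ ((hZ v).mp hv).1
      have e2 : (ladder (offDiag 0 1) (limitDiag p) (N + 1)).mulVec _ ∈ W :=
        hW 3 _ ((hZ v).mp hv).2
      have h1 := ladder_lower_mulVec (limitDiag p) v 0
      have h2 := ladder_lower_mulVec (limitDiag p) 0 v
      simp only [map_zero, add_zero, zero_add, Matrix.mulVec_zero] at h1 h2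
      rw [h1] at e1
      rw [h2] at e2
      exact (hZ _).mpr ⟨(W.add_mem_iff_left ((hZ _).mp (hH v hv)).2).mp e1, e2⟩
    have hZinv : ∀ i, ∀ v ∈ Z, (limitGen p N i).mulVec v ∈ Z := by
      intro i
      fin_cases i
      exacts [hZ0, hZ1, hZ2, hZ3]
    have hpow : ∀ {M : ℕ} {U : Submodule ℂ ((Fin M → Fin 2) → ℂ)}
        {Y : Matrix (Fin M → Fin 2) (Fin M → Fin 2) ℂ}, (∀ v ∈ U, Y.mulVec v ∈ U) →
        ∀ (k : ℕ), ∀ v ∈ U, (Y ^ k).mulVec v ∈ U := by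
      intro M U Y hY k v hv
      induction k with
      | zero => simpa using hv
      | succ k ihk => rw [pow_succ', ← Matrix.mulVec_mulVec]; exact hY _ ihk
    obtain ⟨κ, hκ, hlow⟩ := exists_ladder_lower_pow_allPlus hp hq N
    have hL0 : siteVec ![1, 0] (allMinus N) ∈ W := by
      have := hpow (hW 3) N _ hT
      change (ladder (offDiag 0 1) (limitDiag p) (N + 1) ^ N).mulVec _ ∈ W at this
      rwa [ladder_lower_pow_allPlus_succ hp, hlow, map_smul, Submodule.smul_mem_iff _ hκ] at this
    have hL1 : siteVec ![0, 1] (allMinus N) ∈ W := by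
      have e : (ladder (offDiag 0 1) (limitDiag p) (N + 1)).mulVec _ ∈ W := hW 3 _ hL0
      have h := ladder_lower_mulVec (limitDiag p) (allMinus N) 0
      have hHL : (limitDiag p N).mulVec (allMinus N) = ladderWeight p N N • allMinus N :=
        limitDiag_mulVec hp fun b hb => by
          have : b = 1 := by by_contra h; simp [allMinus, h] at hb
          rw [this, minusCount_one]
      rw [map_zero, add_zero, Matrix.mulVec_zero, add_zero, ladder_lower_mulVec_allMinus hp,
        map_zero, zero_add, hHL, map_smul] at h
      rwa [h, Submodule.smul_mem_iff _ (ladderWeight_self_ne_zero hp hq N)] at e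
    have hL : allMinus N ∈ Z := (hZ _).mpr ⟨hL0, hL1⟩
    have hEL := hpow hZ2 N _ hL
    have hcoord : (ladder (offDiag 1 0) (limitDiag p) N ^ N).mulVec (allMinus N) 0 = κ := by
      have h1 := congrFun hlow 1
      rw [allPlus, Matrix.mulVec_single_one, Pi.smul_apply, allMinus, Pi.single_eq_same,
        smul_eq_mul, mul_one] at h1
      rw [allMinus, Matrix.mulVec_single_one, ← h1, ← ladder_lower_transpose hp,
        ← Matrix.transpose_pow]
      rfl
    have hTZ : allPlus N ∈ Z := by
      have := mulVec_mem_of_mem_adjoin (W := Z) (s := Set.range (limitGen p N))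
        (by rintro _ ⟨i, rfl⟩; exact hZinv i) (single_zero_mem_adjoin hp hq N) _ hEL
      have hs : (Matrix.single 0 0 1 : Matrix (Fin N → Fin 2) (Fin N → Fin 2) ℂ).mulVec
          ((ladder (offDiag 1 0) (limitDiag p) N ^ N).mulVec (allMinus N)) = κ • allPlus N := by
        rw [Matrix.single_mulVec, hcoord, one_mul, allPlus]
        ext a
        by_cases ha : a = 0 <;> simp [ha]
      rwa [hs, Submodule.smul_mem_iff _ hκ] at this
    have hZtop := ih Z hZinv hTZ
    refine Submodule.eq_top_iff'.mpr fun v => ?_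
    rw [eq_siteVec_add_siteVec v]
    have hall : ∀ v, v ∈ Z := fun v => hZtop ▸ Submodule.mem_top
    exact W.add_mem ((hZ _).mp (hall _)).1 ((hZ _).mp (hall _)).2

theorem adjoin_limitGen {p : ℂ} (hp : p ≠ 0) (hq : ∀ k : ℕ, 1 ≤ k → p ^ (2 * k) ≠ 1) (N : ℕ) :
    Algebra.adjoin ℂ (Set.range (limitGen p N)) = ⊤ := by
  set S := Algebra.adjoin ℂ (Set.range (limitGen p N))
  have hmem : ∀ i, limitGen p N i ∈ S := fun i => Algebra.subset_adjoin ⟨i, rfl⟩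
  have hTT : Matrix.vecMulVec (allPlus N) (allPlus N) ∈ S := by
    rw [allPlus, ← Matrix.single_eq_single_vecMulVec_single]
    exact single_zero_mem_adjoin hp hq N
  have hcol : ∀ v, Matrix.vecMulVec v (allPlus N) ∈ S := by
    let W : Submodule ℂ ((Fin N → Fin 2) → ℂ) :=
      { carrier := {v | Matrix.vecMulVec v (allPlus N) ∈ S}
        add_mem' := fun h1 h2 => by
          simpa only [Set.mem_ofPred_eq, Matrix.add_vecMulVec] using S.add_mem h1 h2
        zero_mem' := by simp
        smul_mem' := fun r v h => by
          simpa only [Set.mem_ofPred_eq, Matrix.smul_vecMulVec] using S.smul_mem h r }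
    have : W = ⊤ := eq_top_of_allPlus_mem hp hq N W (fun i v hv => by
      change Matrix.vecMulVec _ _ ∈ S
      rw [← Matrix.mul_vecMulVec]
      exact S.mul_mem (hmem i) hv) hTT
    intro v
    exact (this ▸ Submodule.mem_top : v ∈ W)
  have hrow : ∀ v, Matrix.vecMulVec (allPlus N) v ∈ S := by
    let W : Submodule ℂ ((Fin N → Fin 2) → ℂ) :=
      { carrier := {v | Matrix.vecMulVec (allPlus N) v ∈ S}
        add_mem' := fun h1 h2 => by
          simpa only [Set.mem_ofPred_eq, Matrix.vecMulVec_add] using S.add_mem h1 h2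
        zero_mem' := by simp
        smul_mem' := fun r v h => by
          simpa only [Set.mem_ofPred_eq, Matrix.vecMulVec_smul] using S.smul_mem h r }
    have : W = ⊤ := eq_top_of_allPlus_mem hp hq N W (fun i v hv => by
      obtain ⟨j, hj⟩ := exists_limitGen_transpose hp N i
      change Matrix.vecMulVec _ _ ∈ S
      rw [← Matrix.vecMul_transpose, hj, ← Matrix.vecMulVec_mul]
      exact S.mul_mem hv (hmem j)) hTT
    intro v
    exact (this ▸ Submodule.mem_top : v ∈ W)
  refine Algebra.eq_top_iff.mpr fun Y => ?_
  rw [Matrix.matrix_eq_sum_single Y]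
  refine S.sum_mem fun a _ => S.sum_mem fun b _ => ?_
  have h := S.smul_mem (S.mul_mem (hcol (Pi.single a 1)) (hrow (Pi.single b 1))) (Y a b)
  rw [Matrix.vecMulVec_mul_vecMulVec] at h
  have hd : allPlus N ⬝ᵥ allPlus N = 1 := by simp [allPlus]
  rw [hd, one_smul, ← Matrix.single_eq_single_vecMulVec_single, Matrix.smul_single, smul_eq_mul,
    mul_one] at h
  exact h

end LimitAlgebra

/-! ### Irreducibility for generic parameters -/

section Generic

/-- Two chains with opposite `K`, and the two ladder operators that occur in their
`q`-commutators. -/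
def chainGen {R : Type*} [CommRing R] (a b p p' c c' : R) (N : ℕ) :
    Fin 4 → Matrix (Fin N → Fin 2) (Fin N → Fin 2) R :=
  ![chain (offDiag a b) (diagTwo p p') c N, chain (offDiag a b) (diagTwo p' p) c' N,
    ladder (offDiag 1 0) (fun M =>
      chain (offDiag a b) (diagTwo p p') c M + chain (offDiag a b) (diagTwo p' p) c' M) N,
    ladder (offDiag 0 1) (fun M =>
      chain (offDiag a b) (diagTwo p p') c M + chain (offDiag a b) (diagTwo p' p) c' M) N]

theorem offDiag_map {R S : Type*} [CommRing R] [CommRing S] (f : R →+* S) (a b : R) :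
    (offDiag a b).map f = offDiag (f a) (f b) := by
  ext i j; fin_cases i <;> fin_cases j <;> simp [offDiag]

theorem diagTwo_map {R S : Type*} [CommRing R] [CommRing S] (f : R →+* S) (a b : R) :
    (diagTwo a b).map f = diagTwo (f a) (f b) := by
  ext i j; fin_cases i <;> fin_cases j <;> simp [diagTwo]

theorem smul_offDiag {R : Type*} [CommRing R] (r a b : R) :
    r • offDiag a b = offDiag (r * a) (r * b) := by
  ext i j; fin_cases i <;> fin_cases j <;> simp [offDiag]

theorem chainGen_map {R S : Type*} [CommRing R] [CommRing S] (f : R →+* S) (a b p p' c c' : R)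
    (N : ℕ) (i : Fin 4) :
    (chainGen a b p p' c c' N i).map f
      = chainGen (f a) (f b) (f p) (f p') (f c) (f c') N i := by
  fin_cases i <;>
    simp [chainGen, chain_map, ladder_map, offDiag_map, diagTwo_map, Matrix.map_add f (map_add f)]

/-- The ladder operators belong to the algebra generated by the two chains. -/
theorem chainGen_mem_adjoin {a b p c c' : ℂ} (ha : a ≠ 0) (hb : b ≠ 0) (hp : p ≠ 0)
    (hp2 : p ^ 2 - p⁻¹ ^ 2 ≠ 0) (N : ℕ) (i : Fin 4) :
    chainGen a b p p⁻¹ c c' N i ∈ Algebra.adjoin ℂ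
      {chain (offDiag a b) (diagTwo p p⁻¹) c N, chain (offDiag a b) (diagTwo p⁻¹ p) c' N} := by
  set S := Algebra.adjoin ℂ
      {chain (offDiag a b) (diagTwo p p⁻¹) c N, chain (offDiag a b) (diagTwo p⁻¹ p) c' N}
  have hA : chain (offDiag a b) (diagTwo p p⁻¹) c N ∈ S := Algebra.subset_adjoin (by simp)
  have hB : chain (offDiag a b) (diagTwo p⁻¹ p) c' N ∈ S := Algebra.subset_adjoin (by simp)
  have hmem : ∀ {r s : ℂ} {Y Z : Matrix (Fin N → Fin 2) (Fin N → Fin 2) ℂ}, s ≠ 0 →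
      Y = r • 1 + s • Z → Y ∈ S → Z ∈ S := by
    intro r s Y Z hs h hY
    have : Z = s⁻¹ • (Y - r • 1) := by
      rw [h, add_sub_cancel_left, smul_smul, inv_mul_cancel₀ hs, one_smul]
    rw [this]
    exact S.smul_mem (S.sub_mem hY (S.smul_mem S.one_mem _)) _
  fin_cases i
  · exact hA
  · exact hB
  · exact hmem (mul_ne_zero ha hp2) (qCommutator_chain p p⁻¹ a b c c' (mul_inv_cancel₀ hp) N)
      (S.sub_mem (S.smul_mem (S.mul_mem hA hB) _) (S.smul_mem (S.mul_mem hB hA) _))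
  · exact hmem (mul_ne_zero hb hp2) (qCommutator_chain' p p⁻¹ a b c c' (mul_inv_cancel₀ hp) N)
      (S.sub_mem (S.smul_mem (S.mul_mem hB hA) _) (S.smul_mem (S.mul_mem hA hB) _))

/-- Two chains generate the full matrix algebra for some boundary parameters: those close enough to
infinity in the direction `(p⁻¹, -p)`. -/
theorem exists_adjoin_chain_eq_top {a b p : ℂ} (ha : a ≠ 0) (hb : b ≠ 0) (hp : p ≠ 0)
    (hq : ∀ k : ℕ, 1 ≤ k → p ^ (2 * k) ≠ 1) (N : ℕ) :
    ∃ c c' : ℂ, Algebra.adjoin ℂ {chain (offDiag a b) (diagTwo p p⁻¹) c N,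
      chain (offDiag a b) (diagTwo p⁻¹ p) c' N} = ⊤ := by
  let g : Fin 4 → Matrix (Fin N → Fin 2) (Fin N → Fin 2) (Polynomial ℂ) :=
    chainGen (Polynomial.X * Polynomial.C a) (Polynomial.X * Polynomial.C b) (Polynomial.C p)
      (Polynomial.C p⁻¹) (Polynomial.C p⁻¹) (Polynomial.C (-p)) N
  have hg : ∀ s : ℂ, (fun i => (g i).map (Polynomial.aeval s : Polynomial ℂ →ₐ[ℂ] ℂ))
      = chainGen (s * a) (s * b) p p⁻¹ p⁻¹ (-p) N := by
    intro s
    funext i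
    have := chainGen_map (Polynomial.aeval s : Polynomial ℂ →ₐ[ℂ] ℂ).toRingHom
      (Polynomial.X * Polynomial.C a) (Polynomial.X * Polynomial.C b) (Polynomial.C p)
      (Polynomial.C p⁻¹) (Polynomial.C p⁻¹) (Polynomial.C (-p)) N i
    refine this.trans ?_
    congr 1 <;> simp <;> ring
  obtain ⟨D, hD0, hD⟩ := exists_ne_zero_adjoin_eq_top g (Polynomial.aeval (0 : ℂ)) (by
    rw [hg, zero_mul, zero_mul]
    exact adjoin_limitGen hp hq N)
  have hXD : Polynomial.X * D ≠ 0 :=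
    mul_ne_zero Polynomial.X_ne_zero fun h => hD0 (by rw [h, map_zero])
  obtain ⟨s, hs⟩ : ∃ s : ℂ, (Polynomial.X * D).eval s ≠ 0 := by
    by_contra! h
    exact hXD (Polynomial.funext fun s => by rw [h s, Polynomial.eval_zero])
  rw [Polynomial.eval_mul, Polynomial.eval_X] at hs
  have hs0 := left_ne_zero_of_mul hs
  have htop := hD (Polynomial.aeval s) (by
    rw [Polynomial.coe_aeval_eq_eval]; exact right_ne_zero_of_mul hs)
  rw [hg] at htop
  refine ⟨s⁻¹ * p⁻¹, s⁻¹ * -p, top_le_iff.mp (htop ▸ Algebra.adjoin_le ?_)⟩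
  rintro _ ⟨i, rfl⟩
  have hp2 : p ^ 2 - p⁻¹ ^ 2 ≠ 0 := by
    intro h
    refine hq 2 (by norm_num) ?_
    have := sub_eq_zero.mp h
    field_simp at this
    simpa using this
  refine SetLike.le_def.mp (Algebra.adjoin_le ?_)
    (chainGen_mem_adjoin (mul_ne_zero hs0 ha) (mul_ne_zero hs0 hb) hp hp2 N i)
  have hscale : ∀ (r r' c : ℂ), chain (offDiag (s * a) (s * b)) (diagTwo r r') c N
      = s • chain (offDiag a b) (diagTwo r r') (s⁻¹ * c) N := by
    intro r r' c
    rw [← chain_smul, smul_offDiag, mul_inv_cancel_left₀ hs0]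
  rintro Y (rfl | rfl)
  · rw [hscale]
    exact Subalgebra.smul_mem _ (Algebra.subset_adjoin (by simp)) _
  · rw [hscale]
    exact Subalgebra.smul_mem _ (Algebra.subset_adjoin (by simp)) _

theorem exists_add_inv_eq (c : ℂ) : ∃ x : ℂ, x ≠ 0 ∧ (x + x⁻¹) / 2 = c := by
  obtain ⟨z, rfl⟩ := Complex.cos_surjective c
  refine ⟨Complex.exp (z * Complex.I), Complex.exp_ne_zero _, ?_⟩
  rw [Complex.cos, ← Complex.exp_neg, neg_mul]

/-- For generic boundary parameters, in the sense of a nonzero polynomial, the two chains generate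
the full matrix algebra. -/
theorem exists_mvPolynomial_adjoin_chain_eq_top {a b p : ℂ} (ha : a ≠ 0) (hb : b ≠ 0) (hp : p ≠ 0)
    (hq : ∀ k : ℕ, 1 ≤ k → p ^ (2 * k) ≠ 1) (N : ℕ) :
    ∃ D : MvPolynomial (Fin 2) ℂ, D ≠ 0 ∧ ∀ x y : ℂ, x ≠ 0 → y ≠ 0 →
      MvPolynomial.eval ![x, y] D ≠ 0 →
      Algebra.adjoin ℂ {chain (offDiag a b) (diagTwo p p⁻¹) ((x + x⁻¹) / 2) N,
        chain (offDiag a b) (diagTwo p⁻¹ p) ((y + y⁻¹) / 2) N} = ⊤ := by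
  -- Multiplied by `x`, the first chain becomes polynomial in `x`; likewise the second one in `y`.
  let h (r r' : ℂ) (i : Fin 2) : Matrix (Fin N → Fin 2) (Fin N → Fin 2) (MvPolynomial (Fin 2) ℂ) :=
    chain (offDiag (MvPolynomial.X i * MvPolynomial.C a) (MvPolynomial.X i * MvPolynomial.C b))
      (diagTwo (MvPolynomial.C r) (MvPolynomial.C r'))
      (MvPolynomial.C 2⁻¹ * (MvPolynomial.X i ^ 2 + 1)) N
  have hh : ∀ (r r' : ℂ) (i : Fin 2) (u : Fin 2 → ℂ), u i ≠ 0 →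
      (h r r' i).map (MvPolynomial.aeval u : MvPolynomial (Fin 2) ℂ →ₐ[ℂ] ℂ)
        = u i • chain (offDiag a b) (diagTwo r r') ((u i + (u i)⁻¹) / 2) N := by
    intro r r' i u hu
    have := chain_map (MvPolynomial.aeval u : MvPolynomial (Fin 2) ℂ →ₐ[ℂ] ℂ).toRingHom
      (offDiag (MvPolynomial.X i * MvPolynomial.C a) (MvPolynomial.X i * MvPolynomial.C b))
      (diagTwo (MvPolynomial.C r) (MvPolynomial.C r'))
      (MvPolynomial.C 2⁻¹ * (MvPolynomial.X i ^ 2 + 1)) N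
    rw [offDiag_map, diagTwo_map] at this
    refine this.trans ?_
    rw [← chain_smul, smul_offDiag]
    congr 1
    · simp
    · simp
    · have : (MvPolynomial.aeval u : MvPolynomial (Fin 2) ℂ →ₐ[ℂ] ℂ)
        (MvPolynomial.C 2⁻¹ * (MvPolynomial.X i ^ 2 + 1)) = 2⁻¹ * (u i ^ 2 + 1) := by simp
      refine this.trans ?_
      field_simp
  have hrange : ∀ x y : ℂ, x ≠ 0 → y ≠ 0 →
      Algebra.adjoin ℂ (Set.range fun i => ((![h p p⁻¹ 0, h p⁻¹ p 1] :
        Fin 2 → Matrix (Fin N → Fin 2) (Fin N → Fin 2) (MvPolynomial (Fin 2) ℂ)) i).map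
        (MvPolynomial.aeval ![x, y] : MvPolynomial (Fin 2) ℂ →ₐ[ℂ] ℂ))
      = Algebra.adjoin ℂ {chain (offDiag a b) (diagTwo p p⁻¹) ((x + x⁻¹) / 2) N,
        chain (offDiag a b) (diagTwo p⁻¹ p) ((y + y⁻¹) / 2) N} := by
    intro x y hx hy
    have h0 := hh p p⁻¹ 0 ![x, y] hx
    have h1 := hh p⁻¹ p 1 ![x, y] hy
    refine le_antisymm (Algebra.adjoin_le ?_) (Algebra.adjoin_le ?_)
    · rintro _ ⟨i, rfl⟩
      fin_cases i
      · refine (congrArg (· ∈ _) h0).mpr ?_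
        exact Subalgebra.smul_mem _ (Algebra.subset_adjoin (Set.mem_insert _ _)) _
      · refine (congrArg (· ∈ _) h1).mpr ?_
        exact Subalgebra.smul_mem _
          (Algebra.subset_adjoin (Set.mem_insert_of_mem _ (Set.mem_singleton _))) _
    · rintro Y (rfl | rfl)
      · rw [← one_smul ℂ (chain _ _ _ N), ← inv_mul_cancel₀ hx, ← smul_smul]
        exact Subalgebra.smul_mem _ (Algebra.subset_adjoin (Set.mem_range.mpr ⟨0, h0⟩)) _
      · rw [← one_smul ℂ (chain _ _ _ N), ← inv_mul_cancel₀ hy, ← smul_smul]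
        exact Subalgebra.smul_mem _ (Algebra.subset_adjoin (Set.mem_range.mpr ⟨1, h1⟩)) _
  obtain ⟨c, c', hcc⟩ := exists_adjoin_chain_eq_top ha hb hp hq N
  obtain ⟨x₀, hx₀, rfl⟩ := exists_add_inv_eq c
  obtain ⟨y₀, hy₀, rfl⟩ := exists_add_inv_eq c'
  obtain ⟨D, hD0, hD⟩ := exists_ne_zero_adjoin_eq_top ![h p p⁻¹ 0, h p⁻¹ p 1]
    (MvPolynomial.aeval ![x₀, y₀]) ((hrange x₀ y₀ hx₀ hy₀).trans hcc)
  refine ⟨D, fun h => hD0 (by rw [h, map_zero]), fun x y hx hy hxy => ?_⟩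
  rw [← hrange x y hx hy]
  exact hD _ (by rwa [MvPolynomial.aeval_eq_eval])

theorem eq_bot_or_eq_top_of_adjoin_eq_top {n : Type*} [Fintype n] [DecidableEq n]
    {s : Set (Matrix n n ℂ)} (hs : Algebra.adjoin ℂ s = ⊤) {W : Submodule ℂ (n → ℂ)}
    (hW : ∀ Y ∈ s, ∀ v ∈ W, Y.mulVec v ∈ W) : W = ⊥ ∨ W = ⊤ := by
  refine or_iff_not_imp_left.mpr fun hne => Submodule.eq_top_iff'.mpr fun u => ?_
  obtain ⟨v, hv, hv0⟩ := Submodule.exists_mem_ne_zero_of_ne_bot hne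
  obtain ⟨i, hi⟩ := Function.ne_iff.mp hv0
  have hmem : Matrix.vecMulVec u (Pi.single i (v i)⁻¹) ∈ Algebra.adjoin ℂ s := by rw [hs]; trivial
  have := mulVec_mem_of_mem_adjoin hW hmem v hv
  rw [Matrix.vecMulVec_mulVec] at this
  simpa [inv_mul_cancel₀ hi] using this

/-- For generic `x`, `y` the pair of chains is irreducible, uniformly in `w`: a diagonal gauge
transformation reduces to `w = 1`. -/
theorem exists_mvPolynomial_irreducible {p : ℂ} (hp : p ≠ 0)
    (hq : ∀ k : ℕ, 1 ≤ k → p ^ (2 * k) ≠ 1) (N : ℕ) :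
    ∃ D : MvPolynomial (Fin 2) ℂ, D ≠ 0 ∧ ∀ w x y : ℂ, w ≠ 0 → x ≠ 0 → y ≠ 0 →
      MvPolynomial.eval ![x, y] D ≠ 0 → ∀ W : Submodule ℂ ((Fin N → Fin 2) → ℂ),
      (∀ v ∈ W, (chain (spinX p w) (diagTwo p p⁻¹) ((x + x⁻¹) / 2) N).mulVec v ∈ W) →
      (∀ v ∈ W, (chain (spinX p w) (diagTwo p⁻¹ p) ((y + y⁻¹) / 2) N).mulVec v ∈ W) →
      W = ⊥ ∨ W = ⊤ := by
  have hpp : (p - p⁻¹) / 2 ≠ 0 := by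
    refine div_ne_zero (sub_ne_zero.mpr fun h => hq 1 le_rfl ?_) two_ne_zero
    rw [mul_one, sq]
    nth_rewrite 1 [h]
    exact inv_mul_cancel₀ hp
  obtain ⟨D, hD0, hD⟩ := exists_mvPolynomial_adjoin_chain_eq_top
    (a := -((p - p⁻¹) / 2 * 1)) (b := (p - p⁻¹) / 2 * 1⁻¹) (by simpa using hpp)
    (by simpa using hpp) hp hq N
  refine ⟨D, hD0, fun w x y hw hx hy hxy W hA hB => ?_⟩
  set G := chain (0 : Matrix (Fin 2) (Fin 2) ℂ) (diagTwo w 1) 1 N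
  set G' := chain (0 : Matrix (Fin 2) (Fin 2) ℂ) (diagTwo w⁻¹ 1) 1 N
  have hGG' : G * G' = 1 := by
    have : diagTwo w 1 * diagTwo w⁻¹ 1 = 1 := by
      ext i j; fin_cases i <;> fin_cases j <;> simp [diagTwo, hw]
    rw [chain_zero_mul, this, mul_one, chain_zero_one]
  have hX : diagTwo w 1 * spinX p 1 = spinX p w * diagTwo w 1 := by
    ext i j; fin_cases i <;> fin_cases j <;> simp [diagTwo, spinX, offDiag]
    · ring
    · field_simp
  have hK : ∀ r r' : ℂ, diagTwo w 1 * diagTwo r r' = diagTwo r r' * diagTwo w 1 := by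
    intro r r'
    ext i j; fin_cases i <;> fin_cases j <;> simp [diagTwo, mul_comm]
  have hgauge : ∀ (r r' c : ℂ), (∀ v ∈ W, (chain (spinX p w) (diagTwo r r') c N).mulVec v ∈ W) →
      ∀ v ∈ W.comap (Matrix.toLin' G),
        (chain (spinX p 1) (diagTwo r r') c N).mulVec v ∈ W.comap (Matrix.toLin' G) := by
    intro r r' c h v hv
    rw [Submodule.mem_comap, Matrix.toLin'_apply] at hv ⊢
    rw [Matrix.mulVec_mulVec, chain_gauge hX (hK r r'), ← Matrix.mulVec_mulVec]
    exact h _ hv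
  have hsurj : ∀ v, v ∈ W ↔ G'.mulVec v ∈ W.comap (Matrix.toLin' G) := by
    intro v
    rw [Submodule.mem_comap, Matrix.toLin'_apply, Matrix.mulVec_mulVec, hGG', Matrix.one_mulVec]
  rcases eq_bot_or_eq_top_of_adjoin_eq_top (hD x y hx hy hxy) (W := W.comap (Matrix.toLin' G))
    (by
      rintro Y (rfl | rfl)
      · exact hgauge _ _ _ hA
      · exact hgauge _ _ _ hB) with h | h
  · left
    refine (Submodule.eq_bot_iff _).mpr fun v hv => ?_
    have := (hsurj v).mp hv
    rw [h, Submodule.mem_bot] at this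
    rw [← Matrix.one_mulVec v, ← hGG', ← Matrix.mulVec_mulVec, this, Matrix.mulVec_zero]
  · right
    exact Submodule.eq_top_iff'.mpr fun v => (hsurj v).mpr (h ▸ Submodule.mem_top)

end Generic

/-! ### The spin chain -/

section Main

theorem W₀_eq_chain (φ : ℂ) (θ : ℝ) (α : ℂ) (N : ℕ) :
    W₀ φ θ α N = chain (kPlus φ θ • sigmaPlus + kMinus φ θ • sigmaMinus) (expSigmaThree (φ / 2))
      (Complex.cosh α) N := by
  induction N with
  | zero => rfl
  | succ N ih => rw [W₀, chain, ih, tensorLeft_eq_siteTensor, tensorLeft_eq_siteTensor]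

theorem W₁_eq_chain (φ : ℂ) (θ : ℝ) (α : ℂ) (N : ℕ) :
    W₁ φ θ α N = chain (kPlus φ θ • sigmaPlus + kMinus φ θ • sigmaMinus) (expSigmaThree (-φ / 2))
      (Complex.cosh α) N := by
  induction N with
  | zero => rfl
  | succ N ih => rw [W₁, chain, ih, tensorLeft_eq_siteTensor, tensorLeft_eq_siteTensor]

theorem spin_matrix_eq_spinX {φ : ℂ} (hφ : φ.re = 0) (θ : ℝ) :
    kPlus φ θ • sigmaPlus + kMinus φ θ • sigmaMinus
      = spinX (Complex.exp (φ / 2)) (Complex.exp (Complex.I * θ)) := by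
  have hconj : (starRingEnd ℂ) φ = -φ := Complex.ext (by simp [hφ]) (by simp)
  have hm : kMinus φ θ = (Complex.exp (φ / 2) - (Complex.exp (φ / 2))⁻¹) / 2
      * (Complex.exp (Complex.I * θ))⁻¹ := by
    rw [kMinus, kPlus, Complex.star_def, ← Complex.exp_neg, ← Complex.exp_neg]
    simp only [map_div₀, map_mul, map_neg, map_sub, ← Complex.exp_conj, hconj, Complex.conj_I,
      Complex.conj_ofReal, map_ofNat, neg_neg, neg_div, neg_mul]
    ring
  have hk : kPlus φ θ = -((Complex.exp (φ / 2) - (Complex.exp (φ / 2))⁻¹) / 2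
      * Complex.exp (Complex.I * θ)) := by
    rw [kPlus, ← Complex.exp_neg, neg_div 2 φ]
    ring
  rw [hm, hk]
  ext i j
  fin_cases i <;> fin_cases j <;> simp [sigmaPlus, sigmaMinus, spinX, offDiag]

theorem expSigmaThree_eq_diagTwo (z : ℂ) :
    expSigmaThree z = diagTwo (Complex.exp z) (Complex.exp z)⁻¹ := by
  rw [expSigmaThree, Complex.exp_neg, diagTwo]

theorem cosh_eq_add_inv (z : ℂ) : Complex.cosh z = (Complex.exp z + (Complex.exp z)⁻¹) / 2 := by
  rw [Complex.cosh, Complex.exp_neg]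

theorem spinX_inv_neg (p w : ℂ) : spinX p⁻¹ (-w) = spinX p w := by
  rw [spinX, spinX, inv_inv, inv_neg]
  congr 1 <;> ring

/-- The condition `IsGenericParam` holds off the zero set of a nonzero polynomial. -/
theorem exists_mvPolynomial_isGenericParam (p : ℂ) (N : ℕ) (i : Fin 2) :
    ∃ D : MvPolynomial (Fin 2) ℂ, D ≠ 0 ∧ ∀ u : Fin 2 → ℂ, MvPolynomial.eval u D ≠ 0 →
      IsGenericParam p (u i) N := by
  refine ⟨∏ j ∈ Finset.Icc (-(N : ℤ)) N,
    (MvPolynomial.X i ^ 2 * MvPolynomial.C (p ^ (2 * j)) - 1), fun h => ?_, fun u hu j hj => ?_⟩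
  · have := congrArg (MvPolynomial.eval 0) h
    simp at this
  · rw [MvPolynomial.eval_prod, Finset.prod_ne_zero_iff] at hu
    have := hu j (Finset.mem_Icc.mpr (abs_le.mp hj))
    simpa [sub_eq_zero] using this

end Main

theorem mainTheorem6 (N : ℕ) (φ : ℂ) (hφ : φ.re = 0)
    (hq : ∀ k : ℕ, 1 ≤ k → Complex.exp φ ^ k ≠ 1) :
    ∃ P : MvPolynomial (Fin 2) ℂ, P ≠ 0 ∧
      ∀ (α αs : ℂ) (θ : ℝ),
        MvPolynomial.eval ![Complex.exp α, Complex.exp αs] P ≠ 0 →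
          IsTridiagonalPair (Matrix.toLin' (W₀ φ θ α N)) (Matrix.toLin' (W₁ φ θ αs N)) ∧
          HasDiameterAndShape (Matrix.toLin' (W₀ φ θ α N)) (Matrix.toLin' (W₁ φ θ αs N))
            N (fun n => N.choose n) := by
  obtain ⟨p, hpdef⟩ : ∃ p, p = Complex.exp (φ / 2) := ⟨_, rfl⟩
  have hp : p ≠ 0 := hpdef ▸ Complex.exp_ne_zero _
  have hq' : ∀ k : ℕ, 1 ≤ k → p ^ (2 * k) ≠ 1 := by
    intro k hk
    rw [pow_mul, sq, hpdef, ← Complex.exp_add, add_halves]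
    exact hq k hk
  have hqinv : ∀ k : ℕ, 1 ≤ k → p⁻¹ ^ (2 * k) ≠ 1 := by
    intro k hk
    rw [inv_pow, inv_ne_one]
    exact hq' k hk
  obtain ⟨P₁, hP₁, h₁⟩ := exists_mvPolynomial_irreducible hp hq' N
  obtain ⟨P₂, hP₂, h₂⟩ := exists_mvPolynomial_isGenericParam p N 0
  obtain ⟨P₃, hP₃, h₃⟩ := exists_mvPolynomial_isGenericParam p⁻¹ N 1
  refine ⟨P₁ * P₂ * P₃, mul_ne_zero (mul_ne_zero hP₁ hP₂) hP₃, fun α αs θ hP => ?_⟩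
  rw [map_mul, map_mul] at hP
  have hw : Complex.exp (Complex.I * θ) ≠ 0 := Complex.exp_ne_zero _
  have hx : Complex.exp α ≠ 0 := Complex.exp_ne_zero _
  have hy : Complex.exp αs ≠ 0 := Complex.exp_ne_zero _
  have hA : W₀ φ θ α N = chain (spinX p (Complex.exp (Complex.I * θ))) (diagTwo p p⁻¹)
      ((Complex.exp α + (Complex.exp α)⁻¹) / 2) N := by
    rw [W₀_eq_chain, spin_matrix_eq_spinX hφ, cosh_eq_add_inv, expSigmaThree_eq_diagTwo,
      hpdef]
  have hB : W₁ φ θ αs N = chain (spinX p (Complex.exp (Complex.I * θ))) (diagTwo p⁻¹ p)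
      ((Complex.exp αs + (Complex.exp αs)⁻¹) / 2) N := by
    rw [W₁_eq_chain, spin_matrix_eq_spinX hφ, cosh_eq_add_inv, expSigmaThree_eq_diagTwo, neg_div,
      Complex.exp_neg, inv_inv, hpdef]
  have hx_gen : IsGenericParam p (Complex.exp α) N :=
    h₂ ![Complex.exp α, Complex.exp αs] (right_ne_zero_of_mul (left_ne_zero_of_mul hP))
  have hy_gen : IsGenericParam p⁻¹ (Complex.exp αs) N :=
    h₃ ![Complex.exp α, Complex.exp αs] (right_ne_zero_of_mul hP)
  obtain ⟨hdA, U, hU, hUdim⟩ := exists_isStandardOrdering_chain hp hq' hw hx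
    hx_gen ((Complex.exp αs + (Complex.exp αs)⁻¹) / 2)
  -- The second chain is obtained from the first one by `(p, w) ↦ (p⁻¹, -w)`.
  obtain ⟨hdB, U', hU', hUdim'⟩ := exists_isStandardOrdering_chain (inv_ne_zero hp) hqinv
    (neg_ne_zero.mpr hw) hy hy_gen
    ((Complex.exp α + (Complex.exp α)⁻¹) / 2)
  rw [inv_inv, spinX_inv_neg] at hdB hU'
  rw [hA, hB]
  refine ⟨⟨inferInstance, inferInstance, hdA, hdB, ⟨N, U, hU⟩, ⟨N, U', hU'⟩, fun W hWA hWB => ?_⟩,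
    ⟨U, hU, hUdim⟩, ⟨U', hU', hUdim'⟩⟩
  exact h₁ _ _ _ hw hx hy (left_ne_zero_of_mul (left_ne_zero_of_mul hP)) W
    (fun v hv => hWA ⟨v, hv, rfl⟩) (fun v hv => hWB ⟨v, hv, rfl⟩)
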